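/- **Setting.** $N$ agents rigidly grasp a rigid object of mass $m_o>0$. The object frame (at the centre of mass) has position $p_o(t)$ and rotation matrix $R_o(t)$; agent $i$ has position $p_i$, rotation matrix $R_i$, angular velocity $\omega_i$. The grasp positions ${}^or_i=R_o^{\mathsf T}(p_i-p_o)$ and the relative orientations $R_o^{\mathsf T}R_i$ are constant. The end-effector forces $f_i$ obey $m_i(\ddot p_i-\ddot p_i^d)+d_i(\dot p_i-\dot p_i^d)+k_i(p_i-p_i^d)=f_i-f_i^d$ with known $m_i,d_i,k_i>0$ and known reference signals, and $m_o(\ddot p_o-g)=-\sum_i f_i$. Let ${}^or_{j,i}={}^or_j-{}^or_i$. The unknown parameters are $\vartheta=({}^or_1,\dots,{}^or_N,m_o)\in\mathbb R^{3N+1}$. Agent $i$ uses $\theta_i=(({}^or_{j,i})_{j\neq i},\,m_o\,{}^or_i,\,m_o)\in\mathbb R^{3N+1}$. With $S(a)b=a\times b$ and $T_i=S(\dot\omega_i)+S(\omega_i)^2$, its regressor matrix $\phi_i^{\mathsf T}\in\mathbb R^{3\times(3N+1)}$ has the block columns $(m_jT_i+d_jS(\omega_i)+k_jI)R_o$ ($j\ne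 i$), $-T_iR_o$, $\ddot p_i-g$, and its output is $y_i=\sum_j(m_j\ddot p_j^d+d_j\dot p_j^d+k_jp_j^d-f_j^d)-\big(\sum_j m_j\big)\ddot p_i-\big(\sum_j d_j\big)\dot p_i-\big(\sum_j k_j\big)p_i$. The trajectories and $\vartheta$ are deterministic. **Data.** At sampling step $k$, let $\phi_{i,m}^{(k)}\in\mathbb R^{3N+1}$ be the $m$-th row of $\phi_i^{\mathsf T}$ and let $t_{i,m}^{(k)}=y_{i,m}^{(k)}+\varepsilon_{i,m}^{(k)}$ be the target ($m=1,2,3$). For each $(i,m)$ the noise $(\varepsilon^{(k)}_{i,m})_k$ is i.i.d. $\mathcal N(0,\beta^{-1})$, where $\beta>0$, and the prior $\mathcal N(\mu_{i,m}^{(0)},\Sigma_{i,m}^{(0)})$ with $\Sigma^{(0)}_{i,m}$ positive definite is correct, in the sense that the prior mean has law $\mu_{i,m}^{(0)}\sim\mathcal N(\theta_i,\Sigma_{i,m}^{(0)})$ and is independent of $(\varepsilon^{(k)}_{i,m})_k$. Nothing is assumed about dependence between different pairs $(i,m)$. **Local estimates.** With $\phi=\phi_{i,m}^{(k+1)}$,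 Bayesian linear regression gives $\Sigma_{i,m}^{(k+1)}=\big((\Sigma_{i,m}^{(k)})^{-1}+\beta\phi\phi^{\mathsf T}\big)^{-1}$ and $\mu_{i,m}^{(k+1)}=\Sigma_{i,m}^{(k+1)}\big((\Sigma_{i,m}^{(k)})^{-1}\mu_{i,m}^{(k)}+\beta\phi\, t_{i,m}^{(k+1)}\big)$. Set $\Sigma_i^{(k)}=3\big(\sum_m(\Sigma_{i,m}^{(k)})^{-1}\big)^{-1}$ and $\mu_i^{(k)}=\frac13\Sigma_i^{(k)}\sum_m(\Sigma_{i,m}^{(k)})^{-1}\mu_{i,m}^{(k)}$. For an entry $a$ of $\theta_i$, let $\hat a$ and $v_a$ be the corresponding entry of $\mu_i^{(k)}$ and diagonal entry of $\Sigma_i^{(k)}$ (agent and step suppressed). Elementwise, agent $i$ puts $\hat r_i=\widehat{m_or_i}/\hat m_o$, $v_{r_i}=\hat r_i^2\big(v_{m_or_i}/\widehat{m_or_i}^2+v_{m_o}/\hat m_o^2\big)$ and, for $j\ne i$, $\hat r_j=\hat r_i+\hat r_{j,i}$, $v_{r_j}=v_{r_i}+v_{r_{j,i}}$. Let $\hat\mu_i^{(k)}=(\hat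 r_1,\dots,\hat r_N,\hat m_o)$ and $\hat\sigma_i^{(k)}=(v_{r_1},\dots,v_{r_N},v_{m_o})$. **Consensus.** Let $\psi_i^{(k)}=(\hat\mu_i^{(k)}/\hat\sigma_i^{(k)},\,1/\hat\sigma_i^{(k)})$, $\xi_i^{(0)}=\psi_i^{(0)}$ and $\xi_i^{(k+1)}=\xi_i^{(k)}+\sum_{j\ne i}A^{ij}(\xi_j^{(k)}-\xi_i^{(k)})+\psi_i^{(k)}-\psi_i^{(k-1)}$ with $\psi_i^{(-1)}=\psi_i^{(0)}$. The consensus estimate $\tilde\mu_i^{(k)}$ is the elementwise quotient of the first half of $\xi_i^{(k)}$ by its second half. The communication graph (edge from $j$ to $i$ iff $A^{ij}>0$) is strongly connected, $A\mathbf 1=A^{\mathsf T}\mathbf 1=\mathbf 1$, and for some $\alpha>0$ all $A^{ii}\ge\alpha$ and all $A^{ij}\in\{0\}\cup[\alpha,1]$. **Bound.** Let $\delta\in(0,1)$ and $\eta_i^{(k)}=\sqrt{2\log\!\big(6N(3N+1)/\delta\big)}\,\sum_{m=1}^3\big|\tfrac13\Sigma_i^{(k)}(\Sigma_{i,m}^{(k)})^{-1}\big|\,\sigma_{i,m}^{(k)}$,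 where $|\cdot|$ is elementwise and $\sigma_{i,m}^{(k)}$ is the vector of square roots of the diagonal entries of $\Sigma_{i,m}^{(k)}$. Write $\eta_{i,a}$ for the entry of $\eta_i^{(k)}$ belonging to $a$, with $\eta_{i,r_{i,i}}=0$, and let, elementwise, $$\eta_{r_i}=\max_{\pm,\pm}\Big|\frac{\widehat{m_or_i}}{\hat m_o}-\frac{\widehat{m_or_i}\pm\eta_{i,m_or_i}}{\hat m_o\pm\eta_{i,m_o}}\Big|\quad\text{(all four choices of signs, estimates of agent } i).$$ With $(v_{r_j})_n$ and $(v_{m_o})_n$ denoting the variances of agent $n$, let $\hat\eta^{(k)}=(\hat\eta_{r_1},\dots,\hat\eta_{r_N},\hat\eta_{m_o})$ be given by $$\hat\eta_{r_j}=\sum_{i=1}^N\frac{\eta_{r_i}+\eta_{i,r_{j,i}}}{(v_{r_j})_i\sum_{n=1}^N 1/(v_{r_j})_n},\qquad \hat\eta_{m_o}=\sum_{i=1}^N\frac{\eta_{i,m_o}}{(v_{m_o})_i\sum_{n=1}^N1/(v_{m_o})_n}.$$ **Theorem.** Let $G$ be the event that the realized data satisfy both (a) there is $K$ with $|(\hat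 m_o)_i^{(k)}|-\eta_{i,m_o}^{(k)}>0$ for all $i$ and all $k\ge K$, and (b) for every $i$, every entry of $1/\hat\sigma_i^{(k)}$ converges, as $k\to\infty$, to a (finite) positive limit. Let $B_k$ be the event that $|\tilde\mu_i^{(k)}-\vartheta|\le\hat\eta^{(k)}$ holds elementwise for all agents $i=1,\dots,N$ simultaneously. Then $$\liminf_{k\to\infty}P\big(G^{c}\cup B_k\big)\ge 1-\delta .$$ In particular, if (a) and (b) hold almost surely, then $\liminf_{k\to\infty}P(B_k)\ge1-\delta$. -/

import Mathlib

open MeasureTheory ProbabilityTheory Filter Topology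
open scoped ENNReal Matrix

noncomputable section

namespace CoopManip

/-! ### Rigid-body kinematics and the manipulation system -/

/-- Vectors of `ℝ³`. -/
abbrev V3 : Type := Fin 3 → ℝ

/-- Real `3 × 3` matrices. -/
abbrev M3 : Type := Matrix (Fin 3) (Fin 3) ℝ

/-- The skew-symmetric matrix `S(a)` with `S(a) b = a × b`. -/
def skew (a : V3) : M3 :=
  !![0, -a 2, a 1;
     a 2, 0, -a 0;
     -a 1, a 0, 0]

theorem skew_mulVec (a b : V3) : skew a *ᵥ b = crossProduct a b := by
  rw [cross_apply]
  ext i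
  fin_cases i <;> simp [skew, Matrix.mulVec, dotProduct, Fin.sum_univ_three] <;> ring

/-- The matrix `T(ω, ω') = S(ω') + S(ω)²` of the acceleration transformation. -/
def accMatrix (w dw : V3) : M3 := skew dw + skew w * skew w

/-- The motion of a body-fixed frame in world coordinates, for positive times: position `p`,
velocity `v`, acceleration `a`, rotation matrix `R`, angular velocity `w` and angular
acceleration `dw`. -/
structure FrameMotion where
  p : ℝ → V3
  v : ℝ → V3
  a : ℝ → V3
  R : ℝ → M3
  w : ℝ → V3
  dw : ℝ → V3
  hasDeriv_p : ∀ t, 0 < t → HasDerivAt p (v t) t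
  hasDeriv_v : ∀ t, 0 < t → HasDerivAt v (a t) t
  R_mem : ∀ t, 0 < t → R t ∈ Matrix.specialOrthogonalGroup (Fin 3) ℝ
  hasDeriv_R : ∀ t, 0 < t → ∀ x y : Fin 3,
    HasDerivAt (fun s => R s x y) ((skew (w t) * R t) x y) t
  hasDeriv_w : ∀ t, 0 < t → HasDerivAt w (dw t) t

/-- `N` impedance-controlled agents that rigidly grasp a common rigid object
(translational part of the dynamics). -/
structure ManipulationSystem (N : ℕ) where
  /-- motion of the object frame, located at the centre of mass -/
  obj : FrameMotion
  /-- motion of the end-effector frames -/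
  agent : Fin N → FrameMotion
  /-- grasp positions in the object frame -/
  r : Fin N → V3
  /-- orientations of the agent frames relative to the object frame -/
  Q : Fin N → M3
  rigid_pos : ∀ i t, 0 < t → (obj.R t)ᵀ *ᵥ ((agent i).p t - obj.p t) = r i
  rigid_rot : ∀ i t, 0 < t → (obj.R t)ᵀ * (agent i).R t = Q i
  /-- object mass -/
  mo : ℝ
  mo_pos : 0 < mo
  /-- gravity vector -/
  g : V3
  /-- virtual masses, dampings and stiffnesses of the agents -/
  mass : Fin N → ℝ
  damp : Fin N → ℝ
  stiff : Fin N → ℝ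
  mass_pos : ∀ i, 0 < mass i
  damp_pos : ∀ i, 0 < damp i
  stiff_pos : ∀ i, 0 < stiff i
  /-- reference signals: positions, velocities, accelerations and forces -/
  pd : Fin N → ℝ → V3
  vd : Fin N → ℝ → V3
  ad : Fin N → ℝ → V3
  fd : Fin N → ℝ → V3
  /-- end-effector forces -/
  f : Fin N → ℝ → V3
  impedance : ∀ i t, 0 < t →
    mass i • ((agent i).a t - ad i t) + damp i • ((agent i).v t - vd i t)
      + stiff i • ((agent i).p t - pd i t) = f i t - fd i t
  object_dynamics : ∀ t, 0 < t → mo • obj.a t - mo • g = ∑ i, -f i t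

/-- Index type of the parameter vectors; it has `3N + 1` elements. -/
abbrev Idx (N : ℕ) : Type := (Fin N × Fin 3) ⊕ Unit

namespace ManipulationSystem

variable {N : ℕ} (S : ManipulationSystem N)

/-- The unknown parameters `ϑ = (r_1, …, r_N, m_o)`: grasp positions and object mass. -/
def vartheta : Idx N → ℝ
  | Sum.inl jc => S.r jc.1 jc.2
  | Sum.inr _ => S.mo

/-- The regression parameters `θ_i` of agent `i`. The block `j ≠ i` holds `r_j - r_i`, the block `i`
holds `m_o r_i`, and the last entry is `m_o`. -/
def theta (i : Fin N) : Idx N → ℝ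
  | Sum.inl jc => if jc.1 = i then S.mo * S.r i jc.2 else S.r jc.1 jc.2 - S.r i jc.2
  | Sum.inr _ => S.mo

/-- The output `y_i(z_i)` computed by agent `i` from its own state at time `t`
and the reference signals. -/
def output (i : Fin N) (t : ℝ) : V3 :=
  ∑ j, (S.mass j • S.ad j t + S.damp j • S.vd j t + S.stiff j • S.pd j t - S.fd j t)
    - (∑ j, S.mass j) • (S.agent i).a t - (∑ j, S.damp j) • (S.agent i).v t
    - (∑ j, S.stiff j) • (S.agent i).p t

/-- The object orientation as computed by agent `i` from its own orientation. -/
def localRot (i : Fin N) (t : ℝ) : M3 := (S.agent i).R t * (S.Q i)ᵀ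

/-- The `3 × (3N+1)` regressor matrix `φ_i(z_i)ᵀ` of agent `i` at time `t`, with the columns
arranged as the entries of `θ_i`. -/
def regressor (i : Fin N) (t : ℝ) : Matrix (Fin 3) (Idx N) ℝ := fun x l =>
  match l with
  | Sum.inl jc =>
      if jc.1 = i then
        (-(accMatrix ((S.agent i).w t) ((S.agent i).dw t) * S.localRot i t)) x jc.2
      else
        ((S.mass jc.1 • accMatrix ((S.agent i).w t) ((S.agent i).dw t)
          + S.damp jc.1 • skew ((S.agent i).w t) + S.stiff jc.1 • (1 : M3))
            * S.localRot i t) x jc.2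
  | Sum.inr _ => ((S.agent i).a t - S.g) x

end ManipulationSystem

/-! ### The distributed Bayesian estimator -/

/-- The deterministic ingredients of the learning problem. -/
structure Setup (N : ℕ) where
  sys : ManipulationSystem N
  /-- noise precision -/
  β : ℝ
  β_pos : 0 < β
  /-- sampling times -/
  τ : ℕ → ℝ
  τ_pos : ∀ k, 0 < τ k
  /-- prior covariance of the expert for output `m` of agent `i` -/
  priorCov : Fin N → Fin 3 → Matrix (Idx N) (Idx N) ℝ
  priorCov_posDef : ∀ i m, (priorCov i m).PosDef
  /-- weighted adjacency matrix of the communication graph -/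
  A : Matrix (Fin N) (Fin N) ℝ

/-- One realization of the random ingredients: the prior means of the experts and the noise
of the measured outputs. -/
structure Sample (N : ℕ) where
  priorMean : Fin N → Fin 3 → Idx N → ℝ
  noise : Fin N → Fin 3 → ℕ → ℝ

namespace Setup

variable {N : ℕ} (E : Setup N)

/-- The feature vector of output `m` of agent `i` at step `k`. -/
def feature (i : Fin N) (m : Fin 3) (k : ℕ) : Idx N → ℝ := E.sys.regressor i (E.τ k) m

/-- The training target `t_{i,m}^{(k)}`: output plus noise. -/
def target (X : Sample N) (i : Fin N) (m : Fin 3) (k : ℕ) : ℝ :=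
  E.sys.output i (E.τ k) m + X.noise i m k

/-- The posterior covariance `Σ_{i,m}^{(k)}` of Bayesian linear regression. -/
def expertCov (i : Fin N) (m : Fin 3) : ℕ → Matrix (Idx N) (Idx N) ℝ
  | 0 => E.priorCov i m
  | k + 1 => ((expertCov i m k)⁻¹
      + E.β • Matrix.vecMulVec (E.feature i m (k + 1)) (E.feature i m (k + 1)))⁻¹

/-- The posterior mean `μ_{i,m}^{(k)}` of Bayesian linear regression. -/
def expertMean (X : Sample N) (i : Fin N) (m : Fin 3) : ℕ → Idx N → ℝ
  | 0 => X.priorMean i m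
  | k + 1 => E.expertCov i m (k + 1) *ᵥ
      ((E.expertCov i m k)⁻¹ *ᵥ expertMean X i m k
        + (E.β * E.target X i m (k + 1)) • E.feature i m (k + 1))

/-- The covariance `Σ_i^{(k)}` of the generalized product of the three experts of agent `i`. -/
def aggCov (i : Fin N) (k : ℕ) : Matrix (Idx N) (Idx N) ℝ :=
  (3 : ℝ) • (∑ m, (E.expertCov i m k)⁻¹)⁻¹

/-- The mean `μ_i^{(k)}` of the generalized product of the three experts of agent `i`. -/
def aggMean (X : Sample N) (i : Fin N) (k : ℕ) : Idx N → ℝ :=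
  (1 / 3 : ℝ) • (E.aggCov i k *ᵥ ∑ m, (E.expertCov i m k)⁻¹ *ᵥ E.expertMean X i m k)

/-- The estimate of `m_o` of agent `i`. -/
def massEst (X : Sample N) (i : Fin N) (k : ℕ) : ℝ := E.aggMean X i k (Sum.inr ())

/-- The estimate of the component `c` of `m_o r_i` of agent `i`. -/
def momentEst (X : Sample N) (i : Fin N) (k : ℕ) (c : Fin 3) : ℝ :=
  E.aggMean X i k (Sum.inl (i, c))

/-- The estimate of `r_i` of agent `i`: ratio of the estimates of `m_o r_i` and `m_o`. -/
def ratioEst (X : Sample N) (i : Fin N) (k : ℕ) (c : Fin 3) : ℝ :=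
  E.momentEst X i k c / E.massEst X i k

/-- The variance attached to `ratioEst`, from the Taylor approximation of the ratio
distribution. -/
def ratioVar (X : Sample N) (i : Fin N) (k : ℕ) (c : Fin 3) : ℝ :=
  (E.ratioEst X i k c) ^ 2 *
    (E.aggCov i k (Sum.inl (i, c)) (Sum.inl (i, c)) / (E.momentEst X i k c) ^ 2
      + E.aggCov i k (Sum.inr ()) (Sum.inr ()) / (E.massEst X i k) ^ 2)

/-- The local means of agent `i` for the parameters `ϑ`. -/
def localMean (X : Sample N) (i : Fin N) (k : ℕ) : Idx N → ℝ
  | Sum.inl jc =>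
      if jc.1 = i then E.ratioEst X i k jc.2
      else E.ratioEst X i k jc.2 + E.aggMean X i k (Sum.inl jc)
  | Sum.inr _ => E.massEst X i k

/-- The local variances of agent `i` for the parameters `ϑ`. -/
def localVar (X : Sample N) (i : Fin N) (k : ℕ) : Idx N → ℝ
  | Sum.inl jc =>
      if jc.1 = i then E.ratioVar X i k jc.2
      else E.ratioVar X i k jc.2 + E.aggCov i k (Sum.inl jc) (Sum.inl jc)
  | Sum.inr _ => E.aggCov i k (Sum.inr ()) (Sum.inr ())

/-- The input `ψ_i^{(k)}` of the consensus: precision-weighted means, and precisions. -/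
def psi (X : Sample N) (i : Fin N) (k : ℕ) : Idx N ⊕ Idx N → ℝ
  | Sum.inl l => E.localMean X i k l / E.localVar X i k l
  | Sum.inr l => 1 / E.localVar X i k l

/-- The dynamic average consensus states `ξ_i^{(k)}`. In the first step `k - 1` is read as `0`,
i.e. `ψ^{(-1)} = ψ^{(0)}`. -/
def xi (X : Sample N) : ℕ → Fin N → Idx N ⊕ Idx N → ℝ
  | 0 => fun i => E.psi X i 0
  | k + 1 => fun i => xi X k i
      + ∑ j ∈ Finset.univ.erase i, E.A i j • (xi X k j - xi X k i)
      + E.psi X i k - E.psi X i (k - 1)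

end Setup

/-- The map `ζ` from consensus states to means and variances. -/
def zeta {N : ℕ} (s : Idx N ⊕ Idx N → ℝ) : Idx N ⊕ Idx N → ℝ
  | Sum.inl l => s (Sum.inl l) / s (Sum.inr l)
  | Sum.inr l => 1 / s (Sum.inr l)

namespace Setup

variable {N : ℕ} (E : Setup N)

/-- The consensus estimate of agent `i` for the parameters `ϑ`. -/
def consensusMean (X : Sample N) (i : Fin N) (k : ℕ) (l : Idx N) : ℝ :=
  zeta (E.xi X k i) (Sum.inl l)

/-! ### The error bound -/

/-- The bound `η_i^{(k)}` for the error of `aggMean`. -/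
def eta (δ : ℝ) (i : Fin N) (k : ℕ) (l : Idx N) : ℝ :=
  Real.sqrt (2 * Real.log (6 * (N : ℝ) * (3 * (N : ℝ) + 1) / δ)) *
    ∑ m, ∑ l', |((1 / 3 : ℝ) • (E.aggCov i k * (E.expertCov i m k)⁻¹)) l l'| *
      Real.sqrt (E.expertCov i m k l' l')

/-- The error of the quotient at the corner of the confidence box with signs `s` and `u`. -/
def cornerError (X : Sample N) (δ : ℝ) (i : Fin N) (k : ℕ) (c : Fin 3) (s u : ℝ) : ℝ :=
  |E.momentEst X i k c / E.massEst X i k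
    - (E.momentEst X i k c + s * E.eta δ i k (Sum.inl (i, c)))
        / (E.massEst X i k + u * E.eta δ i k (Sum.inr ()))|

/-- The bound for the error of `ratioEst`: the maximum over the four choices of signs. -/
def ratioBound (X : Sample N) (δ : ℝ) (i : Fin N) (k : ℕ) (c : Fin 3) : ℝ :=
  max (max (E.cornerError X δ i k c 1 1) (E.cornerError X δ i k c 1 (-1)))
    (max (E.cornerError X δ i k c (-1) 1) (E.cornerError X δ i k c (-1) (-1)))

/-- The bound for the error of `localMean`. -/
def localBound (X : Sample N) (δ : ℝ) (i : Fin N) (k : ℕ) : Idx N → ℝ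
  | Sum.inl jc =>
      if jc.1 = i then E.ratioBound X δ i k jc.2
      else E.ratioBound X δ i k jc.2 + E.eta δ i k (Sum.inl jc)
  | Sum.inr _ => E.eta δ i k (Sum.inr ())

/-- The final error bound: average of the local bounds, weighted by the precisions. -/
def finalBound (X : Sample N) (δ : ℝ) (k : ℕ) (l : Idx N) : ℝ :=
  ∑ i, E.localBound X δ i k l / (E.localVar X i k l * ∑ n, 1 / E.localVar X n k l)

/-- The consensus estimates of all agents lie within the final error bound at step `k`. -/
def BoundHolds (X : Sample N) (δ : ℝ) (k : ℕ) : Prop :=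
  ∀ (i : Fin N) (l : Idx N),
    |E.consensusMean X i k l - E.sys.vartheta l| ≤ E.finalBound X δ k l

/-! ### Assumptions -/

/-- The communication graph is strongly connected and balanced, with weights bounded from below.
There is an edge from `b` to `a` iff `A a b > 0`. -/
structure GoodGraph : Prop where
  strongly_connected : ∀ i j : Fin N, Relation.ReflTransGen (fun b a => 0 < E.A a b) i j
  row_sum : ∀ i, ∑ j, E.A i j = 1
  col_sum : ∀ j, ∑ i, E.A i j = 1
  weights : ∃ α : ℝ, 0 < α ∧ (∀ i, α ≤ E.A i i) ∧ ∀ i j, E.A i j = 0 ∨ E.A i j ∈ Set.Icc α 1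

/-- Probabilistic model of the data: for each expert, the prior `N(μ⁽⁰⁾, Σ⁽⁰⁾)` describes the
deviation between prior mean and true parameters, and the output noise is i.i.d. Gaussian with
variance `β⁻¹` and independent of the prior mean. Nothing is assumed on the joint law of
different experts. -/
structure GaussianData {Ω : Type*} [MeasurableSpace Ω] (P : Measure Ω) (X : Ω → Sample N) :
    Prop where
  prior_law : ∀ i m, HasLaw (fun ω => WithLp.toLp 2 ((X ω).priorMean i m))
    (multivariateGaussian (WithLp.toLp 2 (E.sys.theta i)) (E.priorCov i m)) P
  noise_law : ∀ i m k, HasLaw (fun ω => (X ω).noise i m k) (gaussianReal 0 (E.β⁻¹).toNNReal) P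
  noise_indep : ∀ i m, iIndepFun (fun (k : ℕ) ω => (X ω).noise i m k) P
  prior_indep_noise : ∀ i m,
    IndepFun (fun ω => (X ω).priorMean i m) (fun ω => (X ω).noise i m) P

/-- Eventually, the confidence intervals of all agents for the mass exclude `0`. -/
def MassNondegenerate (X : Sample N) (δ : ℝ) : Prop :=
  ∃ K : ℕ, ∀ (i : Fin N) (k : ℕ), K ≤ k →
    0 < |E.massEst X i k| - E.eta δ i k (Sum.inr ())

/-- The local precisions converge to positive limits. -/
def PositiveLimitPrecision (X : Sample N) : Prop :=
  ∀ (i : Fin N) (l : Idx N), ∃ c : ℝ, 0 < c ∧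
    Tendsto (fun k => 1 / E.localVar X i k l) atTop (𝓝 c)

end Setup

end CoopManip

end

namespace CoopManip

/-! ### Kinematics of the grasp -/

/-! Rigidity expresses the motion of every agent through that of agent i, so the output of agent i
is exactly linear in θ_i (`output_eq`). The precision-weighted error of an expert, its score, is
then a linear image of the prior deviation plus a sum of independent noise terms, and scores at
steps j ≤ k have as covariance the precision matrix of step j (`covariance_score`). Hence the
posterior error is centred Gaussian with covariance exactly the posterior covariance. A union bound
over N · 3 · (3N+1) two-sided Gaussian tails controls all experts at one given step. The remaining
estimates are deterministic.

The consensus states reach the precision-weighted average only in the limit, so confidence bounds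
used at full size leave no room for the consensus error. Room comes from demanding the expert errors
to be at most c < 1 times their bounds. The factor c survives aggregation, the quotient and the
weighted average, which leaves a gap of 1 - c times the final bound. That bound stays away from zero
because the local variances have positive limits (`aggCov_le_eta`, `min_le_quotient`), so the
vanishing consensus error eventually fits into the gap. The failure probability is continuous in c,
and c → 1 gives δ.

The consensus error vanishes because the inputs converge (`tendsto_consensus`). Precisions converge
by hypothesis. The aggregated means converge almost surely, whatever the features
(`ae_tendsto_aggMean`): for independent experts their error would be a Gaussian process whose
covariance depends only on the later index, that is, a reverse martingale. The experts of an agent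
may be dependent, so this argument is run on independent copies of the probability space, with signs
that isolate a single expert. -/

theorem skew_injective : Function.Injective skew := by
  intro a b h
  have h1 := congrFun₂ h 2 1
  have h2 := congrFun₂ h 0 2
  have h3 := congrFun₂ h 1 0
  simp [skew] at h1 h2 h3
  ext i
  fin_cases i <;> assumption

theorem hasDerivAt_skew {w : ℝ → V3} {dw : V3} {t : ℝ} (h : HasDerivAt w dw t) (x y : Fin 3) :
    HasDerivAt (fun s => skew (w s) x y) (skew dw x y) t := by
  have h' := hasDerivAt_pi.1 h
  fin_cases x <;> fin_cases y <;>
    simp [skew, h' 0, h' 1, h' 2, (h' 0).fun_neg, (h' 1).fun_neg, (h' 2).fun_neg, hasDerivAt_const]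

theorem hasDerivAt_matrix_mul {A B : ℝ → M3} {A' B' : M3} {t : ℝ}
    (hA : ∀ x y, HasDerivAt (fun s => A s x y) (A' x y) t)
    (hB : ∀ x y, HasDerivAt (fun s => B s x y) (B' x y) t) (x y : Fin 3) :
    HasDerivAt (fun s => (A s * B s) x y) ((A' * B t + A t * B') x y) t := by
  simp only [Matrix.mul_apply, Matrix.add_apply, ← Finset.sum_add_distrib]
  exact HasDerivAt.fun_sum fun z _ => (hA x z).mul (hB z y)

theorem hasDerivAt_matrix_mulVec {A : ℝ → M3} {A' : M3} {t : ℝ}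
    (hA : ∀ x y, HasDerivAt (fun s => A s x y) (A' x y) t) (r : V3) :
    HasDerivAt (fun s => A s *ᵥ r) (A' *ᵥ r) t := by
  refine hasDerivAt_pi.2 fun x => ?_
  simp only [Matrix.mulVec, dotProduct]
  exact HasDerivAt.fun_sum fun z _ => (hA x z).mul_const (r z)

/-- Lets the grasp constraints, which hold only at positive times, be differentiated there. -/
theorem HasDerivAt.eq_of_eqOn_pos {F : Type*} [NormedAddCommGroup F] [NormedSpace ℝ F]
    {f g : ℝ → F} {f' g' : F} {t : ℝ} (ht : 0 < t) (hf : HasDerivAt f f' t)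
    (hg : HasDerivAt g g' t) (h : ∀ s, 0 < s → f s = g s) : f' = g' :=
  hf.unique (hg.congr_of_eventuallyEq ((lt_mem_nhds ht).mono h))

namespace FrameMotion

variable (F : FrameMotion) {t : ℝ}

theorem mul_transpose_self (ht : 0 < t) : F.R t * (F.R t)ᵀ = 1 :=
  (Matrix.mem_orthogonalGroup_iff _ _).1 (Matrix.mem_specialOrthogonalGroup_iff.1 (F.R_mem t ht)).1

end FrameMotion

namespace ManipulationSystem

variable {N : ℕ} (S : ManipulationSystem N) {t : ℝ}

theorem agent_rot (j : Fin N) (ht : 0 < t) : (S.agent j).R t = S.obj.R t * S.Q j := by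
  rw [← S.rigid_rot j t ht, ← mul_assoc, S.obj.mul_transpose_self ht, one_mul]

theorem localRot_eq (j : Fin N) (ht : 0 < t) : S.localRot j t = S.obj.R t := by
  rw [localRot, ← S.rigid_rot j t ht, Matrix.transpose_mul, Matrix.transpose_transpose,
    ← mul_assoc, (S.agent j).mul_transpose_self ht, one_mul]

theorem agent_pos (j : Fin N) (ht : 0 < t) :
    (S.agent j).p t = S.obj.p t + S.obj.R t *ᵥ S.r j := by
  rw [← S.rigid_pos j t ht, Matrix.mulVec_mulVec, S.obj.mul_transpose_self ht, Matrix.one_mulVec]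
  abel

theorem agent_vel (j : Fin N) (ht : 0 < t) :
    (S.agent j).v t = S.obj.v t + (skew (S.obj.w t) * S.obj.R t) *ᵥ S.r j :=
  HasDerivAt.eq_of_eqOn_pos ht ((S.agent j).hasDeriv_p t ht)
    ((S.obj.hasDeriv_p t ht).add (hasDerivAt_matrix_mulVec (S.obj.hasDeriv_R t ht) _))
    fun _ hs => S.agent_pos j hs

/-- Differentiating R_j = R_o Q_j with Q_j constant gives S(ω_j) R_j = S(ω_o) R_j; the rotation
cancels and S is injective. -/
theorem agent_angVel (j : Fin N) (ht : 0 < t) : (S.agent j).w t = S.obj.w t := by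
  have h : skew ((S.agent j).w t) * (S.agent j).R t = skew (S.obj.w t) * (S.agent j).R t := by
    ext x y
    refine HasDerivAt.eq_of_eqOn_pos ht ((S.agent j).hasDeriv_R t ht x y)
      (g := fun s => (S.obj.R s * S.Q j) x y) ?_ fun s hs => by rw [S.agent_rot j hs]
    have := hasDerivAt_matrix_mul (S.obj.hasDeriv_R t ht) (B := fun _ => S.Q j) (B' := 0)
      (fun x y => by simpa using hasDerivAt_const t (S.Q j x y)) x y
    simpa [S.agent_rot j ht, mul_assoc] using this
  have h' := congrArg (· * ((S.agent j).R t)ᵀ) h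
  simp only [mul_assoc, (S.agent j).mul_transpose_self ht, mul_one] at h'
  exact skew_injective h'

theorem agent_angAcc (j : Fin N) (ht : 0 < t) : (S.agent j).dw t = S.obj.dw t :=
  HasDerivAt.eq_of_eqOn_pos ht ((S.agent j).hasDeriv_w t ht) (S.obj.hasDeriv_w t ht)
    fun _ hs => S.agent_angVel j hs

theorem agent_acc (j : Fin N) (ht : 0 < t) :
    (S.agent j).a t =
      S.obj.a t + (accMatrix (S.obj.w t) (S.obj.dw t) * S.obj.R t) *ᵥ S.r j := by
  refine HasDerivAt.eq_of_eqOn_pos ht ((S.agent j).hasDeriv_v t ht)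
    ((S.obj.hasDeriv_v t ht).add (hasDerivAt_matrix_mulVec (A' := _) ?_ _))
    fun _ hs => S.agent_vel j hs
  intro x y
  have := hasDerivAt_matrix_mul (hasDerivAt_skew (S.obj.hasDeriv_w t ht)) (S.obj.hasDeriv_R t ht) x y
  simpa [accMatrix, add_mul, mul_assoc] using this

/-- The output of each agent is linear in its regression parameters. -/
theorem output_eq (i : Fin N) (ht : 0 < t) : S.output i t = S.regressor i t *ᵥ S.theta i := by
  have himp : ∀ j, S.mass j • S.ad j t + S.damp j • S.vd j t + S.stiff j • S.pd j t - S.fd j t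
      = S.mass j • (S.agent j).a t + S.damp j • (S.agent j).v t + S.stiff j • (S.agent j).p t
        - S.f j t := by
    intro j
    ext x
    have := congrFun (S.impedance j t ht) x
    simp only [Pi.add_apply, Pi.sub_apply, Pi.smul_apply, smul_eq_mul] at this ⊢
    linarith
  have hobj := S.object_dynamics t ht
  set T := accMatrix (S.obj.w t) (S.obj.dw t) with hT
  have hreg : S.regressor i t *ᵥ S.theta i =
      ∑ j, (((S.mass j • T + S.damp j • skew (S.obj.w t) + S.stiff j • (1 : M3)) * S.obj.R t)
        *ᵥ (S.r j - S.r i)) - (T * S.obj.R t) *ᵥ (S.mo • S.r i)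
        + S.mo • ((S.agent i).a t - S.g) := by
    ext x
    -- At j = i the difference r_j - r_i vanishes, so the sum may run over all j, and the block i of
    -- the regressor appears only as a correction.
    have key : ∀ j, ∑ c, S.regressor i t x (Sum.inl (j, c)) * S.theta i (Sum.inl (j, c)) =
        (((S.mass j • T + S.damp j • skew (S.obj.w t) + S.stiff j • (1 : M3)) * S.obj.R t)
        *ᵥ (S.r j - S.r i)) x - if j = i then ((T * S.obj.R t) *ᵥ (S.mo • S.r i)) x else 0 := by
      intro j
      by_cases hj : j = i
      · subst hj
        simp [regressor, theta, S.localRot_eq j ht, S.agent_angVel j ht, S.agent_angAcc j ht, ← hT,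
          Matrix.mulVec, dotProduct]
      · simp [regressor, theta, hj, S.localRot_eq i ht, S.agent_angVel i ht, S.agent_angAcc i ht,
          ← hT, Matrix.mulVec, dotProduct]
    simp only [Matrix.mulVec, dotProduct, Fintype.sum_sum_type, Fintype.sum_prod_type] at key ⊢
    simp only [key, Finset.sum_sub_distrib]
    simp [regressor, theta, Matrix.mulVec, dotProduct, mul_comm]
  rw [hreg, output, Finset.sum_congr rfl fun j _ => himp j]
  have hi := S.agent_acc i ht
  -- Every agent's motion is that of agent i shifted by r_j - r_i, and the forces sum to the object
  -- dynamics. Replacing the object acceleration by that of agent i then produces the column of m_o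
  -- r_i.
  have hsum : ∑ j, (S.mass j • (S.agent j).a t + S.damp j • (S.agent j).v t
      + S.stiff j • (S.agent j).p t - S.f j t) =
      ∑ j, (((S.mass j • T + S.damp j • skew (S.obj.w t) + S.stiff j • (1 : M3)) * S.obj.R t)
        *ᵥ (S.r j - S.r i)) + (∑ j, S.mass j) • (S.agent i).a t
        + (∑ j, S.damp j) • (S.agent i).v t + (∑ j, S.stiff j) • (S.agent i).p t
        + ∑ j, -S.f j t := by
    simp only [Finset.sum_smul, ← Finset.sum_add_distrib]
    refine Finset.sum_congr rfl fun j _ => ?_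
    rw [S.agent_acc j ht, S.agent_vel j ht, S.agent_pos j ht, S.agent_acc i ht, S.agent_vel i ht,
      S.agent_pos i ht, ← hT]
    simp only [add_mul, Matrix.add_mulVec, Matrix.mulVec_sub, Matrix.smul_mulVec, smul_mul_assoc,
      one_mul]
    module
  rw [hsum, ← hobj, hi, Matrix.mulVec_smul, ← hT]
  module

end ManipulationSystem

/-! ### Positive definite matrices -/

theorem _root_.Matrix.PosDef.isUnit_det {n : Type*} [Fintype n] [DecidableEq n] {A : Matrix n n ℝ}
    (hA : A.PosDef) : IsUnit A.det :=
  (Matrix.isUnit_iff_isUnit_det _).1 hA.isUnit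

/-- Nonnegativity of the 2 × 2 principal minor at a, b. -/
theorem _root_.Matrix.PosSemidef.abs_apply_le {n : Type*} [Fintype n] {A : Matrix n n ℝ}
    (hA : A.PosSemidef) (a b : n) : |A a b| ≤ √(A a a) * √(A b b) := by
  have h := (hA.submatrix ![a, b]).det_nonneg
  have hsymm : A b a = A a b := hA.isHermitian.apply a b
  simp only [Matrix.det_fin_two, Matrix.submatrix_apply, Matrix.cons_val_zero,
    Matrix.cons_val_one, hsymm] at h
  rw [← Real.sqrt_mul hA.diag_nonneg]
  exact Real.abs_le_sqrt (by nlinarith)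

/-- The diagonal of the inverse decreases when a positive semidefinite matrix is added. -/
theorem _root_.Matrix.PosDef.inv_add_apply_self_le {n : Type*} [Fintype n] [DecidableEq n]
    {A B : Matrix n n ℝ} (hA : A.PosDef) (hB : B.PosSemidef) (a : n) :
    (A + B)⁻¹ a a ≤ A⁻¹ a a := by
  have hAB := hA.add_posSemidef hB
  set x := (A + B)⁻¹ *ᵥ Pi.single a 1 with hx
  set y := A⁻¹ *ᵥ Pi.single a 1 with hy
  have hAy : A *ᵥ y = Pi.single a 1 := by
    rw [hy, Matrix.mulVec_mulVec, Matrix.mul_nonsing_inv _ hA.isUnit_det, Matrix.one_mulVec]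
  have hABx : A *ᵥ x + B *ᵥ x = Pi.single a 1 := by
    rw [← Matrix.add_mulVec, hx, Matrix.mulVec_mulVec, Matrix.mul_nonsing_inv _ hAB.isUnit_det,
      Matrix.one_mulVec]
  -- Expanding (y - x)ᵀA(y - x) ≥ 0 gives y_a - 2 x_a + xᵀAx ≥ 0, while xᵀAx = x_a - xᵀBx ≤ x_a.
  have h1 := hA.posSemidef.dotProduct_mulVec_nonneg (y - x)
  have h2 := hB.dotProduct_mulVec_nonneg x
  have hsymm : y ⬝ᵥ A *ᵥ x = x ⬝ᵥ A *ᵥ y := by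
    rw [Matrix.dotProduct_mulVec, ← Matrix.mulVec_transpose, dotProduct_comm]
    congr 2
    exact hA.isHermitian.eq
  have hxa : x ⬝ᵥ Pi.single a 1 = (A + B)⁻¹ a a := by simp [hx]
  have hya : y ⬝ᵥ Pi.single a 1 = A⁻¹ a a := by simp [hy]
  have h3 : x ⬝ᵥ A *ᵥ x + x ⬝ᵥ B *ᵥ x = (A + B)⁻¹ a a := by
    rw [← dotProduct_add, hABx, hxa]
  simp only [star_trivial, Matrix.mulVec_sub, dotProduct_sub, sub_dotProduct, hsymm, hAy, hxa,
    hya] at h1 h2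
  linarith

namespace Setup

variable {N : ℕ} (E : Setup N)

/-! ### Bayesian linear regression in terms of precisions and scores -/

/-- The posterior precision of an expert. -/
noncomputable def precision (i : Fin N) (m : Fin 3) (k : ℕ) : Matrix (Idx N) (Idx N) ℝ :=
  (E.priorCov i m)⁻¹ + ∑ j ∈ Finset.range k,
    E.β • Matrix.vecMulVec (E.feature i m (j + 1)) (E.feature i m (j + 1))

theorem precision_zero (i : Fin N) (m : Fin 3) : E.precision i m 0 = (E.priorCov i m)⁻¹ := by
  simp [precision]

theorem precision_succ (i : Fin N) (m : Fin 3) (k : ℕ) :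
    E.precision i m (k + 1) = E.precision i m k
      + E.β • Matrix.vecMulVec (E.feature i m (k + 1)) (E.feature i m (k + 1)) := by
  simp [precision, Finset.sum_range_succ, add_assoc]

theorem posSemidef_information (i : Fin N) (m : Fin 3) (k : ℕ) :
    (∑ j ∈ Finset.range k,
      E.β • Matrix.vecMulVec (E.feature i m (j + 1)) (E.feature i m (j + 1))).PosSemidef := by
  refine Matrix.posSemidef_sum _ fun j _ => Matrix.PosSemidef.smul ?_ E.β_pos.le
  simpa using Matrix.posSemidef_vecMulVec_self_star (E.feature i m (j + 1))

theorem precision_posDef (i : Fin N) (m : Fin 3) (k : ℕ) : (E.precision i m k).PosDef :=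
  (E.priorCov_posDef i m).inv.add_posSemidef (E.posSemidef_information i m k)

theorem sum_precision_posDef (i : Fin N) (k : ℕ) : (∑ m, E.precision i m k).PosDef :=
  Matrix.posDef_sum Finset.univ_nonempty fun m _ => E.precision_posDef i m k

theorem expertCov_eq (i : Fin N) (m : Fin 3) (k : ℕ) :
    E.expertCov i m k = (E.precision i m k)⁻¹ := by
  induction k with
  | zero =>
    rw [precision_zero, Matrix.nonsing_inv_nonsing_inv _ (E.priorCov_posDef i m).isUnit_det,
      expertCov]
  | succ k ih =>
    rw [expertCov, ih, Matrix.nonsing_inv_nonsing_inv _ (E.precision_posDef i m k).isUnit_det,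
      precision_succ]

theorem expertCov_inv (i : Fin N) (m : Fin 3) (k : ℕ) :
    (E.expertCov i m k)⁻¹ = E.precision i m k := by
  rw [expertCov_eq, Matrix.nonsing_inv_nonsing_inv _ (E.precision_posDef i m k).isUnit_det]

theorem expertCov_posDef (i : Fin N) (m : Fin 3) (k : ℕ) : (E.expertCov i m k).PosDef := by
  rw [expertCov_eq]
  exact (E.precision_posDef i m k).inv

theorem expertCov_apply_self_le (i : Fin N) (m : Fin 3) (k : ℕ) (l : Idx N) :
    E.expertCov i m k l l ≤ E.priorCov i m l l := by
  rw [expertCov_eq, precision]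
  refine ((E.priorCov_posDef i m).inv.inv_add_apply_self_le
    (E.posSemidef_information i m k) l).trans_eq ?_
  rw [Matrix.nonsing_inv_nonsing_inv _ (E.priorCov_posDef i m).isUnit_det]

theorem aggCov_eq (i : Fin N) (k : ℕ) :
    E.aggCov i k = (3 : ℝ) • (∑ m, E.precision i m k)⁻¹ := by
  simp only [aggCov, expertCov_inv]

theorem aggCov_posDef (i : Fin N) (k : ℕ) : (E.aggCov i k).PosDef := by
  rw [aggCov_eq]
  exact (E.sum_precision_posDef i k).inv.smul (by norm_num)

/-- The precision-weighted error of the posterior mean of an expert. -/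
noncomputable def score (X : Sample N) (i : Fin N) (m : Fin 3) (k : ℕ) : Idx N → ℝ :=
  (E.priorCov i m)⁻¹ *ᵥ (X.priorMean i m - E.sys.theta i) +
    ∑ j ∈ Finset.range k, (E.β * X.noise i m (j + 1)) • E.feature i m (j + 1)

theorem score_succ (X : Sample N) (i : Fin N) (m : Fin 3) (k : ℕ) :
    E.score X i m (k + 1) =
      E.score X i m k + (E.β * X.noise i m (k + 1)) • E.feature i m (k + 1) := by
  simp [score, Finset.sum_range_succ, add_assoc]

theorem target_eq (X : Sample N) (i : Fin N) (m : Fin 3) (k : ℕ) :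
    E.target X i m k = E.feature i m k ⬝ᵥ E.sys.theta i + X.noise i m k := by
  rw [target, E.sys.output_eq i (E.τ_pos k)]
  rfl

/-- The noiseless part of the target cancels against the growth of the precision applied to θ, so
each step adds only a noise term. -/
theorem precision_mulVec_error (X : Sample N) (i : Fin N) (m : Fin 3) (k : ℕ) :
    E.precision i m k *ᵥ (E.expertMean X i m k - E.sys.theta i) = E.score X i m k := by
  induction k with
  | zero => simp [precision_zero, score, expertMean]
  | succ k ih =>
    rw [score_succ, ← ih, expertMean, expertCov_eq, expertCov_inv, Matrix.mulVec_sub,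
      Matrix.mulVec_mulVec, Matrix.mul_nonsing_inv _ (E.precision_posDef i m _).isUnit_det,
      Matrix.one_mulVec, target_eq, precision_succ, Matrix.add_mulVec, Matrix.smul_mulVec,
      Matrix.vecMulVec_mulVec, Matrix.mulVec_sub]
    ext l
    simp
    ring

theorem expertMean_sub (X : Sample N) (i : Fin N) (m : Fin 3) (k : ℕ) :
    E.expertMean X i m k - E.sys.theta i = E.expertCov i m k *ᵥ E.score X i m k := by
  rw [← precision_mulVec_error, expertCov_eq, Matrix.mulVec_mulVec,
    Matrix.nonsing_inv_mul _ (E.precision_posDef i m k).isUnit_det, Matrix.one_mulVec]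

theorem aggMean_sub (X : Sample N) (i : Fin N) (k : ℕ) :
    E.aggMean X i k - E.sys.theta i =
      (∑ m, E.precision i m k)⁻¹ *ᵥ ∑ m, E.score X i m k := by
  simp only [← precision_mulVec_error, aggMean, expertCov_inv, aggCov_eq, Matrix.mulVec_sub,
    Finset.sum_sub_distrib, ← Matrix.sum_mulVec, Matrix.smul_mulVec, Matrix.mulVec_mulVec]
  rw [Matrix.nonsing_inv_mul _ (E.sum_precision_posDef i k).isUnit_det, Matrix.one_mulVec, smul_smul]
  norm_num

/-- The matrix weights are those whose absolute values enter `eta`; this form carries the expert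
bounds over without any assumption on joint laws. -/
theorem aggMean_sub_eq_sum (X : Sample N) (i : Fin N) (k : ℕ) :
    E.aggMean X i k - E.sys.theta i =
      ∑ m, ((1 / 3 : ℝ) • (E.aggCov i k * (E.expertCov i m k)⁻¹)) *ᵥ
        (E.expertMean X i m k - E.sys.theta i) := by
  rw [aggMean_sub, Matrix.mulVec_sum]
  refine Finset.sum_congr rfl fun m _ => ?_
  rw [expertCov_inv, ← precision_mulVec_error, Matrix.mulVec_mulVec, aggCov_eq, smul_mul_assoc,
    smul_smul]
  norm_num

/-! ### Confidence bounds of the aggregated means -/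

/-- The factor of the standard deviations in the confidence bounds. -/
noncomputable def quantile (N : ℕ) (δ : ℝ) : ℝ :=
  √(2 * Real.log (6 * (N : ℝ) * (3 * (N : ℝ) + 1) / δ))

theorem quantile_pos (i : Fin N) {δ : ℝ} (hδ : δ ∈ Set.Ioo (0 : ℝ) 1) : 0 < quantile N δ := by
  have hN : (1 : ℝ) ≤ N := by exact_mod_cast i.pos
  refine Real.sqrt_pos.2 (mul_pos two_pos (Real.log_pos ?_))
  rw [one_lt_div hδ.1]
  nlinarith [hδ.2]

theorem abs_aggMean_sub_le (X : Sample N) (δ c : ℝ) (i : Fin N) (k : ℕ)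
    (h : ∀ m l, |E.expertMean X i m k l - E.sys.theta i l| ≤
      c * quantile N δ * √(E.expertCov i m k l l)) (l : Idx N) :
    |E.aggMean X i k l - E.sys.theta i l| ≤ c * E.eta δ i k l := by
  have := congrFun (E.aggMean_sub_eq_sum X i k) l
  rw [Pi.sub_apply] at this
  rw [this, eta, ← quantile, ← mul_assoc, Finset.sum_apply, Finset.mul_sum]
  refine (Finset.abs_sum_le_sum_abs _ _).trans (Finset.sum_le_sum fun m _ => ?_)
  rw [Matrix.mulVec, dotProduct, Finset.mul_sum]
  refine (Finset.abs_sum_le_sum_abs _ _).trans (Finset.sum_le_sum fun l' _ => ?_)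
  rw [abs_mul, mul_left_comm]
  exact mul_le_mul_of_nonneg_left (h m l') (abs_nonneg _)

theorem eta_nonneg (δ : ℝ) (i : Fin N) (k : ℕ) (l : Idx N) : 0 ≤ E.eta δ i k l := by
  unfold eta
  positivity

/-- A lower bound of the error bound by the variance of the aggregated estimate. -/
theorem aggCov_le_eta (δ : ℝ) (i : Fin N) (k : ℕ) (l : Idx N) :
    quantile N δ / (3 * √(E.priorCov i 0 l l)) * E.aggCov i k l l ≤ E.eta δ i k l := by
  have hp : 0 < √(E.priorCov i 0 l l) := Real.sqrt_pos.2 (E.priorCov_posDef i 0).diag_pos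
  set W := (1 / 3 : ℝ) • (E.aggCov i k * (E.expertCov i 0 k)⁻¹) with hW
  -- One expert suffices, here m = 0: its weight times its own covariance is a third of the
  -- aggregated covariance. Cauchy–Schwarz for the entries of the covariance and its monotone
  -- diagonal do the rest.
  have h1 : E.aggCov i k l l / 3 = ∑ l', W l l' * E.expertCov i 0 k l' l := by
    rw [← Matrix.mul_apply, hW, smul_mul_assoc, mul_assoc,
      Matrix.nonsing_inv_mul _ (E.expertCov_posDef i 0 k).isUnit_det, mul_one, Matrix.smul_apply,
      smul_eq_mul]
    ring
  have h2 : E.aggCov i k l l / 3 ≤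
      (∑ l', |W l l'| * √(E.expertCov i 0 k l' l')) * √(E.priorCov i 0 l l) := by
    rw [h1, Finset.sum_mul]
    refine Finset.sum_le_sum fun l' _ => (le_abs_self _).trans ?_
    rw [abs_mul, mul_assoc]
    refine mul_le_mul_of_nonneg_left ?_ (abs_nonneg _)
    refine ((E.expertCov_posDef i 0 k).posSemidef.abs_apply_le l' l).trans ?_
    gcongr
    exact E.expertCov_apply_self_le i 0 k l
  have h3 : ∑ l', |W l l'| * √(E.expertCov i 0 k l' l') ≤
      ∑ m, ∑ l', |((1 / 3 : ℝ) • (E.aggCov i k * (E.expertCov i m k)⁻¹)) l l'| *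
        √(E.expertCov i m k l' l') :=
    Finset.single_le_sum (f := fun m => ∑ l', |((1 / 3 : ℝ) •
      (E.aggCov i k * (E.expertCov i m k)⁻¹)) l l'| * √(E.expertCov i m k l' l'))
      (fun m _ => by positivity) (Finset.mem_univ 0)
  rw [eta, ← quantile]
  refine le_trans ?_ (mul_le_mul_of_nonneg_left h3 (Real.sqrt_nonneg _))
  rw [div_mul_eq_mul_div, div_le_iff₀ (by positivity)]
  calc quantile N δ * E.aggCov i k l l = 3 * (quantile N δ * (E.aggCov i k l l / 3)) := by ring
    _ ≤ 3 * (quantile N δ * ((∑ l', |W l l'| * √(E.expertCov i 0 k l' l')) *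
        √(E.priorCov i 0 l l))) := by
      gcongr
      exact Real.sqrt_nonneg _
    _ = _ := by rw [quantile]; ring

end Setup

/-! ### Gaussian processes -/

section Gaussian

variable {Ω T : Type*} [MeasurableSpace Ω] {P : Measure Ω} {X : T → Ω → ℝ}

theorem _root_.ProbabilityTheory.IsGaussianProcess.of_mem_span {S : Type*} {Y : S → Ω → ℝ}
    (hX : IsGaussianProcess X P) (hY : ∀ s, Y s ∈ Submodule.span ℝ (Set.range X)) :
    IsGaussianProcess Y P := by
  refine hX.of_isGaussianProcess fun s => ?_
  obtain ⟨c, hc⟩ := Finsupp.mem_span_range_iff_exists_finsupp.1 (hY s)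
  refine ⟨c.support, ∑ t : c.support, c t • ContinuousLinearMap.proj t, fun ω => ?_⟩
  rw [← hc, Finsupp.sum, Finset.sum_apply, ← Finset.sum_coe_sort]
  simp

theorem _root_.ProbabilityTheory.IsGaussianProcess.memLp_two (hX : IsGaussianProcess X P) (t : T) :
    MemLp (X t) 2 P :=
  (hX.hasGaussianLaw_eval t).memLp_two

theorem integral_eq_zero_of_mem_span (hX : ∀ t, Integrable (X t) P) (h0 : ∀ t, ∫ ω, X t ω ∂P = 0)
    {Y : Ω → ℝ} (hY : Y ∈ Submodule.span ℝ (Set.range X)) : ∫ ω, Y ω ∂P = 0 := by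
  suffices h : Integrable Y P ∧ ∫ ω, Y ω ∂P = 0 from h.2
  induction hY using Submodule.span_induction with
  | mem Y h =>
    obtain ⟨t, rfl⟩ := h
    exact ⟨hX t, h0 t⟩
  | zero => exact ⟨integrable_zero _ _ _, by simp⟩
  | add Y Z _ _ hY hZ =>
    exact ⟨hY.1.add hZ.1, by simp only [Pi.add_apply]; rw [integral_add hY.1 hZ.1, hY.2, hZ.2, add_zero]⟩
  | smul c Y _ hY => exact ⟨hY.1.smul c, by simp [integral_const_mul, hY.2]⟩

theorem _root_.ProbabilityTheory.covariance_congr {Y Z Y' Z' : Ω → ℝ} (h : Y =ᵐ[P] Y')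
    (h' : Z =ᵐ[P] Z') : cov[Y, Z; P] = cov[Y', Z'; P] := by
  rw [covariance, covariance, integral_congr_ae h, integral_congr_ae h']
  refine integral_congr_ae ?_
  filter_upwards [h, h'] with ω h1 h2
  rw [h1, h2]

/-- A centered Gaussian process with uncorrelated backward increments converges almost surely. -/
theorem ae_exists_tendsto_of_covariance_of_stronglyMeasurable {e : ℕ → Ω → ℝ}
    (he : IsGaussianProcess e P) (hm : ∀ k, StronglyMeasurable (e k))
    (h0 : ∀ k, ∫ ω, e k ω ∂P = 0)
    (hcov : ∀ j k, j ≤ k → cov[e j, e k; P] = cov[e k, e k; P]) :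
    ∀ᵐ ω ∂P, ∃ L, Tendsto (fun k => e k ω) atTop (𝓝 L) := by
  have := he.isProbabilityMeasure
  have hum : ∀ n, StronglyMeasurable (fun ω => e 0 ω - e n ω) := fun n => (hm 0).sub (hm n)
  set 𝓕 := Filtration.natural (fun n ω => e 0 ω - e n ω) hum with h𝓕
  have hint : ∀ k, Integrable (e k) P := fun k => (he.hasGaussianLaw_eval k).integrable
  -- The later value is uncorrelated with all e 0 - e j, j ≤ n, hence independent of them by joint
  -- Gaussianity.
  have hindep : ∀ n, P[e n | 𝓕 n] =ᵐ[P] fun _ => 0 := by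
    intro n
    have hproc : IsGaussianProcess (Sum.elim (fun _ : Unit => e n)
        fun (j : Set.Iic n) ω => e 0 ω - e j ω) P := by
      refine he.of_mem_span fun s => ?_
      rcases s with s | s
      · exact Submodule.subset_span ⟨n, rfl⟩
      · exact Submodule.sub_mem _ (Submodule.subset_span ⟨0, rfl⟩)
          (Submodule.subset_span ⟨s.1, rfl⟩)
    have hI := hproc.indepFun_of_covariance_eq_zero (fun _ => he.aemeasurable n)
      (fun j => (hum j).measurable.aemeasurable) (by
        intro _ j
        change cov[e n, e 0 - e j; P] = 0
        rw [covariance_sub_right (he.memLp_two n) (he.memLp_two 0) (he.memLp_two j),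
          covariance_comm, hcov 0 n (Nat.zero_le n), covariance_comm (e n) (e j),
          hcov j n j.2, sub_self])
    have hI' : Indep (MeasurableSpace.comap (e n) inferInstance) (𝓕 n) P := by
      rw [h𝓕, Filtration.natural_eq_comap]
      exact hI.comp (φ := fun x : Unit → ℝ => x ()) (measurable_pi_apply ()) measurable_id
    have := condExp_indep_eq (hm n).measurable.comap_le (𝓕.le n)
      (comap_measurable (e n)).stronglyMeasurable hI'
    rwa [h0 n] at this
  -- So e 0 - e n is the conditional expectation of e 0 given the past differences, and Lévy's
  -- upward theorem applies.
  have hcond : ∀ n, P[e 0 | 𝓕 n] =ᵐ[P] fun ω => e 0 ω - e n ω := by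
    intro n
    have h1 : P[fun ω => e 0 ω - e n ω | 𝓕 n] = fun ω => e 0 ω - e n ω :=
      condExp_of_stronglyMeasurable (𝓕.le n)
        (Filtration.stronglyAdapted_natural hum n) ((hint 0).sub (hint n))
    have h2 := condExp_sub (hint 0) (hint n) (𝓕 n) (μ := P)
    filter_upwards [h2, hindep n] with ω h2 h3
    have h4 := congrFun h1 ω
    change (P[e 0 - e n | 𝓕 n]) ω = _ at h4
    rw [h4, Pi.sub_apply, h3, sub_zero] at h2
    exact h2.symm
  filter_upwards [MeasureTheory.tendsto_ae_condExp (μ := P) (ℱ := 𝓕) (e 0), ae_all_iff.2 hcond]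
    with ω hω hω'
  refine ⟨e 0 ω - (P[e 0 | ⨆ n, 𝓕 n]) ω, ?_⟩
  refine (tendsto_const_nhds.sub hω).congr fun n => ?_
  rw [hω' n]
  ring

/-- Measurable modifications remove the measurability assumption needed for the natural filtration.
-/
theorem ae_exists_tendsto_of_covariance {e : ℕ → Ω → ℝ}
    (he : IsGaussianProcess e P) (h0 : ∀ k, ∫ ω, e k ω ∂P = 0)
    (hcov : ∀ j k, j ≤ k → cov[e j, e k; P] = cov[e k, e k; P]) :
    ∀ᵐ ω ∂P, ∃ L, Tendsto (fun k => e k ω) atTop (𝓝 L) := by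
  have hae : ∀ k, e k =ᵐ[P] (he.aemeasurable k).mk := fun k => (he.aemeasurable k).ae_eq_mk
  have := ae_exists_tendsto_of_covariance_of_stronglyMeasurable (he.congr hae)
    (fun k => (he.aemeasurable k).measurable_mk.stronglyMeasurable)
    (fun k => by rw [← integral_congr_ae (hae k), h0 k])
    (fun j k hjk => by
      rw [← covariance_congr (hae j) (hae k), ← covariance_congr (hae k) (hae k), hcov j k hjk])
  filter_upwards [this, ae_all_iff.2 hae] with ω ⟨L, hL⟩ h
  exact ⟨L, hL.congr fun k => (h k).symm⟩

/-- Gaussian processes on the factors of a product space form a joint Gaussian process. -/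
theorem isGaussianProcess_pi {κ : Type*} [Fintype κ] [IsProbabilityMeasure P]
    {X : κ → T → Ω → ℝ} (hX : ∀ m, IsGaussianProcess (X m) P) :
    IsGaussianProcess (fun (p : κ × T) (ω : κ → Ω) => X p.1 p.2 (ω p.1))
      (Measure.pi fun _ : κ => P) where
  hasGaussianLaw I := by
    classical
    set J := I.image Prod.snd
    have h1 : ∀ m, HasGaussianLaw (fun ω : κ → Ω => J.restrict (X m · (ω m)))
        (Measure.pi fun _ : κ => P) := by
      intro m
      constructor
      have := ((hX m).hasGaussianLaw J).isGaussian_map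
      rw [← (measurePreserving_eval (fun _ : κ => P) m).map_eq,
        AEMeasurable.map_map_of_aemeasurable] at this
      · exact this
      · rw [(measurePreserving_eval (fun _ : κ => P) m).map_eq]
        exact ((hX m).hasGaussianLaw J).aemeasurable
      · exact (measurable_pi_apply m).aemeasurable
    have h2 := (iIndepFun_pi (μ := fun _ : κ => P) (X := fun m ω => J.restrict (X m · ω))
      fun m => ((hX m).hasGaussianLaw J).aemeasurable).hasGaussianLaw h1
    let L : (κ → J → ℝ) →L[ℝ] I → ℝ := ContinuousLinearMap.pi fun p =>
      (ContinuousLinearMap.proj (R := ℝ) (φ := fun _ : J => ℝ)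
        ⟨p.1.2, Finset.mem_image_of_mem _ p.2⟩).comp (ContinuousLinearMap.proj p.1.1)
    exact h2.map L

/-- A Gaussian vector and an independent sequence of independent Gaussian variables form a
Gaussian process. -/
theorem isGaussianProcess_sumElim {ι : Type*} [Fintype ι] {Z : ι → Ω → ℝ} {ε : ℕ → Ω → ℝ}
    (hZ : HasGaussianLaw (fun ω a => Z a ω) P) (hε : ∀ k, HasGaussianLaw (ε k) P)
    (hind : iIndepFun ε P) (hZε : IndepFun (fun ω a => Z a ω) (fun ω k => ε k ω) P) :
    IsGaussianProcess (Sum.elim Z ε) P where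
  hasGaussianLaw I := by
    classical
    set J : Finset ℕ := I.toRight
    have h1 : HasGaussianLaw (fun ω (k : J) => ε k ω) P :=
      (hind.precomp Subtype.val_injective).hasGaussianLaw fun k => hε k
    have h2 : IndepFun (fun ω a => Z a ω) (fun ω (k : J) => ε k ω) P :=
      hZε.comp (φ := id) (ψ := fun (x : ℕ → ℝ) (k : J) => x k) measurable_id
        (measurable_pi_lambda _ fun k => measurable_pi_apply (k : ℕ))
    have h3 := h2.hasGaussianLaw hZ h1
    let L : ((ι → ℝ) × (J → ℝ)) →L[ℝ] I → ℝ := ContinuousLinearMap.pi fun p => match p with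
      | ⟨Sum.inl a, _⟩ => (ContinuousLinearMap.proj (R := ℝ) (φ := fun _ : ι => ℝ) a).comp
          (ContinuousLinearMap.fst ℝ _ _)
      | ⟨Sum.inr k, hk⟩ => (ContinuousLinearMap.proj (R := ℝ) (φ := fun _ : J => ℝ)
          ⟨k, Finset.mem_toRight.2 hk⟩).comp (ContinuousLinearMap.snd ℝ _ _)
    have h4 := h3.map L
    convert! h4 using 1
    ext ω p
    rcases p with ⟨a | k, hp⟩ <;> rfl

/-- Two-sided Gaussian tail bound. -/
theorem measure_lt_abs_le_of_hasGaussianLaw [IsProbabilityMeasure P] {Y : Ω → ℝ}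
    (hY : HasGaussianLaw Y P) (h0 : ∫ ω, Y ω ∂P = 0) {v : ℝ} (hv : Var[Y; P] = v) (hv' : 0 < v)
    {x : ℝ} (hx : 0 ≤ x) :
    P {ω | x * √v < |Y ω|} ≤ ENNReal.ofReal (2 * Real.exp (-x ^ 2 / 2)) := by
  have hsub : HasSubgaussianMGF Y v.toNNReal P := by
    have hmap := hY.map_eq_gaussianReal
    have hmap' : P.map Y = gaussianReal 0 v.toNNReal := by rw [hmap, h0, hv]
    refine ⟨fun t => ?_, fun t => ?_⟩
    · have := integrable_exp_mul_gaussianReal (μ := 0) (v := v.toNNReal) t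
      rw [← hmap'] at this
      exact this.comp_aemeasurable hY.aemeasurable
    · rw [mgf_gaussianReal hmap' t, zero_mul, zero_add]
  have hexp : -(x * √v) ^ 2 / (2 * (v.toNNReal : ℝ)) = -x ^ 2 / 2 := by
    rw [Real.coe_toNNReal v hv'.le, mul_pow, Real.sq_sqrt hv'.le]
    field_simp
  have h1 := hsub.measure_ge_le (ε := x * √v) (by positivity)
  have h2 := hsub.neg.measure_ge_le (ε := x * √v) (by positivity)
  rw [hexp] at h1 h2
  have hsubset : {ω | x * √v < |Y ω|} ⊆ {ω | x * √v ≤ Y ω} ∪ {ω | x * √v ≤ (-Y) ω} := by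
    intro ω hω
    rcases lt_abs.1 (show x * √v < |Y ω| from hω) with h | h
    · exact Or.inl h.le
    · exact Or.inr h.le
  rw [← ENNReal.ofReal_toReal (measure_ne_top P _)]
  refine ENNReal.ofReal_le_ofReal ?_
  calc P.real {ω | x * √v < |Y ω|}
      ≤ P.real ({ω | x * √v ≤ Y ω} ∪ {ω | x * √v ≤ (-Y) ω}) := measureReal_mono hsubset
    _ ≤ _ := (measureReal_union_le _ _).trans (add_le_add h1 h2)
    _ = 2 * Real.exp (-x ^ 2 / 2) := by ring

/-- A cylinder has the measure of its base. This brings statements about independent copies back to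
the original space. -/
theorem ae_of_ae_pi_eval {κ : Type*} [Fintype κ] [IsProbabilityMeasure P] (m : κ) {p : Ω → Prop}
    (h : ∀ᵐ ω ∂(Measure.pi fun _ : κ => P), p (ω m)) : ∀ᵐ ω ∂P, p ω := by
  classical
  rw [ae_iff] at h ⊢
  have : {ω : κ → Ω | ¬ p (ω m)} =
      Set.univ.pi fun j => if j = m then {ω | ¬ p ω} else Set.univ := by
    ext ω
    simp only [Set.mem_ofPred_eq, Set.mem_univ_pi]
    refine ⟨fun h j => ?_, fun h => by simpa using h m⟩
    by_cases hj : j = m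
    · subst hj; simpa using h
    · simp [hj]
  rw [this, Measure.pi_pi, Finset.prod_eq_single m (fun j _ hj => by simp [hj]) (by simp)] at h
  simpa using h

end Gaussian

theorem covariance_dotProduct {Ω ι κ : Type*} [MeasurableSpace Ω] {P : Measure Ω}
    [IsFiniteMeasure P] [Fintype ι] [Fintype κ] {Y : ι → Ω → ℝ} {Z : κ → Ω → ℝ}
    (hY : ∀ a, MemLp (Y a) 2 P) (hZ : ∀ b, MemLp (Z b) 2 P) (M : Matrix ι κ ℝ)
    (h : ∀ a b, cov[Y a, Z b; P] = M a b) (u : ι → ℝ) (v : κ → ℝ) :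
    cov[fun ω => u ⬝ᵥ fun a => Y a ω, fun ω => v ⬝ᵥ fun b => Z b ω; P] = u ⬝ᵥ M *ᵥ v := by
  simp only [dotProduct, Matrix.mulVec]
  rw [covariance_fun_sum_fun_sum (fun a => (hY a).const_mul (u a)) fun b => (hZ b).const_mul (v b)]
  simp only [covariance_const_mul_left, covariance_const_mul_right, h, Finset.mul_sum]
  refine Finset.sum_congr rfl fun a _ => Finset.sum_congr rfl fun b _ => by ring

theorem _root_.Matrix.inv_row_vecMul {n : Type*} [Fintype n] [DecidableEq n] {A : Matrix n n ℝ}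
    (hA : IsUnit A.det) (l : n) : A⁻¹ l ᵥ* A = Pi.single l 1 := by
  have h := Matrix.nonsing_inv_mul A hA
  ext b
  change (A⁻¹ * A) l b = _
  rw [h, Matrix.one_apply, Pi.single_apply]
  simp only [eq_comm]

/-! ### Law of the scores and almost sure convergence of the aggregated means -/

namespace Setup

variable {N : ℕ} (E : Setup N) {Ω : Type*}

/-- The deviation of the prior mean together with the noise of an expert. -/
def dataVar (X : Ω → Sample N) (i : Fin N) (m : Fin 3) : Idx N ⊕ ℕ → Ω → ℝ :=
  Sum.elim (fun a ω => (X ω).priorMean i m a - E.sys.theta i a) fun k ω => (X ω).noise i m k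

/-- The scores of an expert, as a stochastic process. -/
noncomputable def scoreVar (X : Ω → Sample N) (i : Fin N) (m : Fin 3) : ℕ × Idx N → Ω → ℝ :=
  fun p ω => E.score (X ω) i m p.1 p.2

/-- Joint Gaussianity and mean zero pass from the data to the scores through this membership. -/
theorem scoreVar_mem_span (X : Ω → Sample N) (i : Fin N) (m : Fin 3) (p : ℕ × Idx N) :
    E.scoreVar X i m p ∈ Submodule.span ℝ (Set.range (E.dataVar X i m)) := by
  obtain ⟨k, a⟩ := p
  have hdata : ∀ t, E.dataVar X i m t ∈
      Submodule.span ℝ (Set.range (E.dataVar X i m)) :=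
    fun t => Submodule.subset_span ⟨t, rfl⟩
  induction k with
  | zero =>
    have : E.scoreVar X i m (0, a) =
        ∑ b, (E.priorCov i m)⁻¹ a b • E.dataVar X i m (Sum.inl b) := by
      ext ω
      simp [scoreVar, dataVar, score, Matrix.mulVec, dotProduct]
    rw [this]
    exact Submodule.sum_mem _ fun b _ => Submodule.smul_mem _ _ (hdata _)
  | succ k ih =>
    have : E.scoreVar X i m (k + 1, a) = E.scoreVar X i m (k, a) +
        (E.β * E.feature i m (k + 1) a) • E.dataVar X i m (Sum.inr (k + 1)) := by
      ext ω
      simp [scoreVar, dataVar, score_succ]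
      ring
    rw [this]
    exact Submodule.add_mem _ ih (Submodule.smul_mem _ _ (hdata _))

namespace GaussianData

variable {E} [MeasurableSpace Ω] {P : Measure Ω} {X : Ω → Sample N} (hX : E.GaussianData P X)
include hX

theorem hasGaussianLaw_prior (i : Fin N) (m : Fin 3) :
    HasGaussianLaw (fun ω a => (X ω).priorMean i m a - E.sys.theta i a) P := by
  have h := hX.prior_law i m
  have h1 : HasLaw (fun ω => WithLp.toLp 2 ((X ω).priorMean i m) - WithLp.toLp 2 (E.sys.theta i))
      ((multivariateGaussian (WithLp.toLp 2 (E.sys.theta i)) (E.priorCov i m)).map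
        (fun x => x - WithLp.toLp 2 (E.sys.theta i))) P :=
    HasLaw.fun_comp (Y := fun x => x - WithLp.toLp 2 (E.sys.theta i)) ⟨by fun_prop, rfl⟩ h
  exact h1.hasGaussianLaw.map_equiv (PiLp.continuousLinearEquiv 2 ℝ fun _ => ℝ)

theorem integral_prior [IsProbabilityMeasure P] (i : Fin N) (m : Fin 3) (a : Idx N) :
    ∫ ω, ((X ω).priorMean i m a - E.sys.theta i a) ∂P = 0 := by
  have h := (measurePreserving_eval_multivariateGaussian (μ := WithLp.toLp 2 (E.sys.theta i))
    (E.priorCov_posDef i m).posSemidef (i := a)).fun_comp_hasLaw (hX.prior_law i m)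
  have hint : Integrable (fun ω => (X ω).priorMean i m a) P := h.hasGaussianLaw.integrable
  have h' : ∫ ω, (X ω).priorMean i m a ∂P = E.sys.theta i a := by
    have := h.integral_eq
    simpa using this
  rw [integral_sub hint (integrable_const _), h']
  simp

theorem covariance_prior [IsProbabilityMeasure P] (i : Fin N) (m : Fin 3) (a b : Idx N) :
    cov[fun ω => (X ω).priorMean i m a - E.sys.theta i a,
      fun ω => (X ω).priorMean i m b - E.sys.theta i b; P] = E.priorCov i m a b := by
  have hint : ∀ a, Integrable (fun ω => (X ω).priorMean i m a) P := fun a =>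
    ((measurePreserving_eval_multivariateGaussian (μ := WithLp.toLp 2 (E.sys.theta i))
      (E.priorCov_posDef i m).posSemidef (i := a)).fun_comp_hasLaw
        (hX.prior_law i m)).hasGaussianLaw.integrable
  rw [covariance_sub_const_left (hint a), covariance_sub_const_right (hint b),
    ← covariance_eval_multivariateGaussian (μ := WithLp.toLp 2 (E.sys.theta i))
      (E.priorCov_posDef i m).posSemidef a b]
  exact (hX.prior_law i m).covariance_fun_comp (f := fun x => x a) (g := fun x => x b)
    (by fun_prop) (by fun_prop)

theorem variance_noise (i : Fin N) (m : Fin 3) (k : ℕ) :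
    cov[fun ω => (X ω).noise i m k, fun ω => (X ω).noise i m k; P] = E.β⁻¹ := by
  rw [covariance_self (hX.noise_law i m k).aemeasurable, (hX.noise_law i m k).variance_eq,
    variance_id_gaussianReal, Real.coe_toNNReal _ (inv_nonneg.2 E.β_pos.le)]

theorem integral_noise (i : Fin N) (m : Fin 3) (k : ℕ) : ∫ ω, (X ω).noise i m k ∂P = 0 := by
  rw [(hX.noise_law i m k).integral_eq, integral_id_gaussianReal]

theorem isGaussianProcess_data (i : Fin N) (m : Fin 3) :
    IsGaussianProcess (E.dataVar X i m) P := by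
  refine isGaussianProcess_sumElim (hX.hasGaussianLaw_prior i m)
    (fun k => (hX.noise_law i m k).hasGaussianLaw) (hX.noise_indep i m) ?_
  exact (hX.prior_indep_noise i m).comp (φ := fun x a => x a - E.sys.theta i a) (ψ := id)
    (by fun_prop) measurable_id

theorem isGaussianProcess_score (i : Fin N) (m : Fin 3) :
    IsGaussianProcess (E.scoreVar X i m) P :=
  (hX.isGaussianProcess_data i m).of_mem_span (E.scoreVar_mem_span X i m)

theorem integral_score [IsProbabilityMeasure P] (i : Fin N) (m : Fin 3) (p : ℕ × Idx N) :
    ∫ ω, E.scoreVar X i m p ω ∂P = 0 := by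
  refine integral_eq_zero_of_mem_span
    (fun t => ((hX.isGaussianProcess_data i m).hasGaussianLaw_eval t).integrable) (fun t => ?_)
    (E.scoreVar_mem_span X i m p)
  rcases t with a | k
  · exact hX.integral_prior i m a
  · exact hX.integral_noise i m k

theorem memLp_noise (i : Fin N) (m : Fin 3) (k : ℕ) :
    MemLp (fun ω => (X ω).noise i m k) 2 P :=
  (hX.isGaussianProcess_data i m).memLp_two (Sum.inr k)

/-- The score of step j involves only the prior deviation and the noise up to step j. -/
theorem covariance_score_noise [IsProbabilityMeasure P] (i : Fin N) (m : Fin 3) (j k : ℕ)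
    (hjk : j < k) (a : Idx N) :
    cov[E.scoreVar X i m (j, a), fun ω => (X ω).noise i m k; P] = 0 := by
  have hprior : ∀ b, MemLp (fun ω => (X ω).priorMean i m b - E.sys.theta i b) 2 P := fun b =>
    (hX.isGaussianProcess_data i m).memLp_two (Sum.inl b)
  induction j with
  | zero =>
    have : E.scoreVar X i m (0, a) =
        fun ω => ∑ b, (E.priorCov i m)⁻¹ a b * ((X ω).priorMean i m b - E.sys.theta i b) := by
      ext ω
      simp [scoreVar, score, Matrix.mulVec, dotProduct]
    rw [this, covariance_fun_sum_left (fun b => (hprior b).const_mul _) (hX.memLp_noise i m k)]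
    refine Finset.sum_eq_zero fun b _ => ?_
    rw [covariance_const_mul_left]
    have hind := (hX.prior_indep_noise i m).comp (φ := fun x => x b - E.sys.theta i b)
      (ψ := fun x : ℕ → ℝ => x k) (by fun_prop)
      (show Measurable fun x : ℕ → ℝ => x k from measurable_pi_apply k)
    have h0 := hind.covariance_eq_zero (hprior b) (hX.memLp_noise i m k)
    exact mul_eq_zero_of_right _ h0
  | succ j ih =>
    have : E.scoreVar X i m (j + 1, a) = E.scoreVar X i m (j, a) +
        fun ω => (E.β * E.feature i m (j + 1) a) * (X ω).noise i m (j + 1) := by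
      ext ω
      simp [scoreVar, score_succ]
      ring
    rw [this, covariance_add_left ((hX.isGaussianProcess_score i m).memLp_two _)
      ((hX.memLp_noise i m _).const_mul _) (hX.memLp_noise i m k), ih (by omega),
      covariance_const_mul_left, ((hX.noise_indep i m).indepFun hjk.ne).covariance_eq_zero
        (hX.memLp_noise i m _) (hX.memLp_noise i m k)]
    simp

/-- The prior contributes Λ₀ Σ₀ Λ₀ = Λ₀, and each sample β² φφᵀ times the noise variance β⁻¹, which
is exactly its increment of precision. -/
theorem covariance_score_self [IsProbabilityMeasure P] (i : Fin N) (m : Fin 3) (k : ℕ)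
    (a b : Idx N) :
    cov[E.scoreVar X i m (k, a), E.scoreVar X i m (k, b); P] =
      E.precision i m k a b := by
  induction k with
  | zero =>
    have h : ∀ a, E.scoreVar X i m (0, a) = fun ω => (E.priorCov i m)⁻¹ a ⬝ᵥ
        fun b => (X ω).priorMean i m b - E.sys.theta i b := by
      intro a
      ext ω
      simp [scoreVar, score, Matrix.mulVec, Pi.sub_def]
    have hmem : ∀ b, MemLp (fun ω => (X ω).priorMean i m b - E.sys.theta i b) 2 P :=
      fun b => (hX.isGaussianProcess_data i m).memLp_two (Sum.inl b)
    rw [h a, h b, covariance_dotProduct hmem hmem (E.priorCov i m)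
      (hX.covariance_prior i m), precision_zero, Matrix.dotProduct_mulVec, dotProduct_comm,
      Matrix.inv_row_vecMul (E.priorCov_posDef i m).isUnit_det, dotProduct_single, mul_one]
    exact (E.priorCov_posDef i m).inv.isHermitian.apply a b
  | succ k ih =>
    have h : ∀ a, E.scoreVar X i m (k + 1, a) = E.scoreVar X i m (k, a) +
        fun ω => (E.β * E.feature i m (k + 1) a) * (X ω).noise i m (k + 1) := by
      intro a
      ext ω
      simp [scoreVar, score_succ]
      ring
    have hs := fun p => (hX.isGaussianProcess_score i m).memLp_two p
    have hn := fun a => (hX.memLp_noise i m (k + 1)).const_mul (E.β * E.feature i m (k + 1) a)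
    rw [h a, h b, covariance_add_left (hs _) (hn a) ((hs _).add (hn b)),
      covariance_add_right (hs _) (hs _) (hn b), covariance_add_right (hn a) (hs _) (hn b), ih,
      covariance_const_mul_right, hX.covariance_score_noise i m k (k + 1) (by omega),
      covariance_const_mul_left, covariance_comm, hX.covariance_score_noise i m k (k + 1) (by omega),
      covariance_const_mul_left, covariance_const_mul_right, hX.variance_noise, precision_succ,
      Matrix.add_apply, Matrix.smul_apply, Matrix.vecMulVec_apply, smul_eq_mul]
    have := E.β_pos.ne'
    field_simp
    ring

theorem covariance_score [IsProbabilityMeasure P] (i : Fin N) (m : Fin 3) (j k : ℕ) (hjk : j ≤ k)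
    (a b : Idx N) :
    cov[E.scoreVar X i m (j, a), E.scoreVar X i m (k, b); P] =
      E.precision i m j a b := by
  induction k, hjk using Nat.le_induction with
  | base => exact hX.covariance_score_self i m j a b
  | succ k hk ih =>
    have h : E.scoreVar X i m (k + 1, b) = E.scoreVar X i m (k, b) +
        fun ω => (E.β * E.feature i m (k + 1) b) * (X ω).noise i m (k + 1) := by
      ext ω
      simp [scoreVar, score_succ]
      ring
    have hs := fun p => (hX.isGaussianProcess_score i m).memLp_two p
    rw [h, covariance_add_right (hs _) (hs _) ((hX.memLp_noise i m (k + 1)).const_mul _), ih,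
      covariance_const_mul_right, hX.covariance_score_noise i m j (k + 1) (by omega), mul_zero,
      add_zero]

/-- The error is Σ times a score of covariance Σ⁻¹, so its variance is the diagonal entry of Σ
itself. -/
theorem measure_lt_abs_expertMean_sub_le [IsProbabilityMeasure P] (i : Fin N) (m : Fin 3) (k : ℕ)
    (l : Idx N) {x : ℝ} (hx : 0 ≤ x) :
    P {ω | x * √(E.expertCov i m k l l) <
      |E.expertMean (X ω) i m k l - E.sys.theta i l|} ≤ ENNReal.ofReal (2 * Real.exp (-x ^ 2 / 2)) := by
  have hY : (fun ω => E.expertMean (X ω) i m k l - E.sys.theta i l) =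
      fun ω => E.expertCov i m k l ⬝ᵥ fun a => E.scoreVar X i m (k, a) ω := by
    ext ω
    exact congrFun (E.expertMean_sub (X ω) i m k) l
  have hspan : (fun ω => E.expertMean (X ω) i m k l - E.sys.theta i l) ∈
      Submodule.span ℝ (Set.range (E.scoreVar X i m)) := by
    have : (fun ω => E.expertMean (X ω) i m k l - E.sys.theta i l) =
        ∑ a, E.expertCov i m k l a • E.scoreVar X i m (k, a) := by
      rw [hY]
      ext ω
      simp [dotProduct]
    rw [this]
    exact Submodule.sum_mem _ fun a _ => Submodule.smul_mem _ _ (Submodule.subset_span ⟨_, rfl⟩)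
  have hs := hX.isGaussianProcess_score i m
  have hG : HasGaussianLaw (fun ω => E.expertMean (X ω) i m k l - E.sys.theta i l) P :=
    (hs.of_mem_span (Y := fun _ : Unit => _) fun _ => hspan).hasGaussianLaw_eval ()
  refine measure_lt_abs_le_of_hasGaussianLaw hG
    (integral_eq_zero_of_mem_span (fun t => (hs.hasGaussianLaw_eval t).integrable)
      (hX.integral_score i m) hspan) ?_ (E.expertCov_posDef i m k).diag_pos hx
  rw [← covariance_self hG.aemeasurable, hY, covariance_dotProduct (fun a => hs.memLp_two (k, a))
    (fun a => hs.memLp_two (k, a)) (E.precision i m k)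
    fun a b => hX.covariance_score_self i m k a b, Matrix.dotProduct_mulVec, expertCov_eq,
    Matrix.inv_row_vecMul (E.precision_posDef i m k).isUnit_det, single_dotProduct, one_mul]

/-- Evaluating the experts at independent coordinates removes the cross-covariances, which are
unknown on the original space. -/
theorem covariance_score_pi [IsProbabilityMeasure P] (i : Fin N) (m n : Fin 3) (j k : ℕ)
    (hjk : j ≤ k) (a b : Idx N) :
    cov[fun ω : Fin 3 → Ω => E.scoreVar X i m (j, a) (ω m),
      fun ω : Fin 3 → Ω => E.scoreVar X i n (k, b) (ω n); Measure.pi fun _ => P] =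
      if m = n then E.precision i m j a b else 0 := by
  have hs := fun m => hX.isGaussianProcess_score i m
  by_cases hmn : m = n
  · subst hmn
    rw [if_pos rfl, ← hX.covariance_score i m j k hjk a b]
    exact (measurePreserving_eval (fun _ : Fin 3 => P) m).hasLaw.covariance_fun_comp
      ((hs m).aemeasurable _) ((hs m).aemeasurable _)
  · rw [if_neg hmn]
    have h1 := (iIndepFun_pi (μ := fun _ : Fin 3 => P)
      (X := fun m ω => (E.scoreVar X i m (j, a) ω, E.scoreVar X i m (k, b) ω))
      fun m => ((hs m).aemeasurable _).prodMk ((hs m).aemeasurable _)).indepFun hmn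
    have h2 := h1.comp measurable_fst measurable_snd
    exact h2.covariance_eq_zero ((isGaussianProcess_pi hs).memLp_two (m, (j, a)))
      ((isGaussianProcess_pi hs).memLp_two (n, (k, b)))

/-- Signs square to one and so leave all covariances unchanged. The covariance of steps j ≤ k is the
diagonal entry of the inverse summed precision at k, which makes the increments backward
uncorrelated. -/
theorem ae_tendsto_signed [IsProbabilityMeasure P] (i : Fin N) (l : Idx N) (s : Fin 3 → ℝ)
    (hs : ∀ m, s m * s m = 1) :
    ∀ᵐ ω ∂(Measure.pi fun _ : Fin 3 => P), ∃ L, Tendsto (fun k =>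
      (∑ m, E.precision i m k)⁻¹ l ⬝ᵥ fun a => ∑ m, s m * E.scoreVar X i m (k, a) (ω m))
      atTop (𝓝 L) := by
  have hG := isGaussianProcess_pi fun m => hX.isGaussianProcess_score i m
  set V : ℕ → Idx N → (Fin 3 → Ω) → ℝ := fun k a ω => ∑ m, s m * E.scoreVar X i m (k, a) (ω m)
  have hVmem : ∀ k a, V k a ∈ Submodule.span ℝ (Set.range
      fun (p : Fin 3 × ℕ × Idx N) (ω : Fin 3 → Ω) => E.scoreVar X i p.1 p.2 (ω p.1)) := by
    intro k a
    have : V k a = ∑ m, s m • fun ω : Fin 3 → Ω => E.scoreVar X i m (k, a) (ω m) := by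
      ext ω
      simp [V]
    rw [this]
    exact Submodule.sum_mem _ fun m _ => Submodule.smul_mem _ _
      (Submodule.subset_span ⟨(m, k, a), rfl⟩)
  have hVG : IsGaussianProcess (fun p : ℕ × Idx N => V p.1 p.2) (Measure.pi fun _ : Fin 3 => P) :=
    hG.of_mem_span fun p => hVmem p.1 p.2
  have hVcov : ∀ j k, j ≤ k → ∀ a b, cov[V j a, V k b; Measure.pi fun _ : Fin 3 => P] =
      (∑ m, E.precision i m j) a b := by
    intro j k hjk a b
    rw [covariance_fun_sum_fun_sum (fun m => (hG.memLp_two (m, j, a)).const_mul (s m))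
      fun m => (hG.memLp_two (m, k, b)).const_mul (s m), Matrix.sum_apply]
    refine Finset.sum_congr rfl fun m _ => ?_
    simp only [covariance_const_mul_left, covariance_const_mul_right,
      hX.covariance_score_pi i m _ j k hjk a b]
    simp [← mul_assoc, hs m]
  have hmem : ∀ k, (fun ω => (∑ m, E.precision i m k)⁻¹ l ⬝ᵥ fun a => V k a ω) ∈
      Submodule.span ℝ (Set.range fun p : ℕ × Idx N => V p.1 p.2) := by
    intro k
    have : (fun ω => (∑ m, E.precision i m k)⁻¹ l ⬝ᵥ fun a => V k a ω) =
        ∑ a, (∑ m, E.precision i m k)⁻¹ l a • V k a := by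
      ext ω
      simp [dotProduct]
    rw [this]
    exact Submodule.sum_mem _ fun a _ => Submodule.smul_mem _ _
      (Submodule.subset_span ⟨(k, a), rfl⟩)
  have hcov : ∀ j k, j ≤ k → cov[fun ω => (∑ m, E.precision i m j)⁻¹ l ⬝ᵥ fun a => V j a ω,
      fun ω => (∑ m, E.precision i m k)⁻¹ l ⬝ᵥ fun a => V k a ω;
      Measure.pi fun _ : Fin 3 => P] = (∑ m, E.precision i m k)⁻¹ l l := by
    intro j k hjk
    rw [covariance_dotProduct (fun a => hVG.memLp_two (j, a)) (fun a => hVG.memLp_two (k, a)) _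
      (hVcov j k hjk), Matrix.dotProduct_mulVec,
      Matrix.inv_row_vecMul (E.sum_precision_posDef i j).isUnit_det, single_dotProduct, one_mul]
  refine ae_exists_tendsto_of_covariance (hVG.of_mem_span hmem) (fun k => ?_)
    fun j k hjk => by rw [hcov j k hjk, hcov k k le_rfl]
  refine integral_eq_zero_of_mem_span (fun t => (hVG.hasGaussianLaw_eval t).integrable)
    (fun p => ?_) (hmem k)
  refine integral_eq_zero_of_mem_span (fun t => (hG.hasGaussianLaw_eval t).integrable)
    (fun q => ?_) (hVmem p.1 p.2)
  rw [← hX.integral_score i q.1 q.2]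
  exact (measurePreserving_eval (fun _ : Fin 3 => P) q.1).hasLaw.integral_comp
    ((hX.isGaussianProcess_score i q.1).aemeasurable q.2).aestronglyMeasurable

theorem ae_tendsto_aggMean [IsProbabilityMeasure P] :
    ∀ᵐ ω ∂P, ∀ i l, ∃ L, Tendsto (fun k => E.aggMean (X ω) i k l) atTop (𝓝 L) := by
  have key : ∀ i l m, ∀ᵐ ω ∂P, ∃ L, Tendsto (fun k =>
      (∑ m, E.precision i m k)⁻¹ l ⬝ᵥ E.score (X ω) i m k) atTop (𝓝 L) := by
    intro i l m
    refine ae_of_ae_pi_eval m ?_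
    -- The two sign patterns agree at m and are opposite elsewhere, so half the sum of the processes
    -- is the term of expert m, a function of the coordinate ω m alone.
    filter_upwards [hX.ae_tendsto_signed i l (fun _ => 1) (by simp),
      hX.ae_tendsto_signed i l (fun n => if n = m then 1 else -1)
        (fun n => by split_ifs <;> norm_num)] with ω ⟨L, hL⟩ ⟨L', hL'⟩
    refine ⟨(L + L') / 2, ((hL.add hL').div_const 2).congr fun k => ?_⟩
    generalize (∑ m, E.precision i m k)⁻¹ l = c
    simp only [dotProduct, Finset.sum_div, ← Finset.sum_add_distrib]
    refine Finset.sum_congr rfl fun a _ => ?_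
    rw [← mul_add, ← Finset.sum_add_distrib, Finset.sum_eq_single m (fun n _ hn => by simp [hn]) (by simp)]
    simp [scoreVar]
    ring
  simp only [ae_all_iff]
  intro i l
  filter_upwards [ae_all_iff.2 (key i l)] with ω hω
  choose L hL using hω
  refine ⟨∑ m, L m + E.sys.theta i l,
    ((tendsto_finsetSum _ fun m _ => hL m).add_const _).congr fun k => ?_⟩
  have := congrFun (E.aggMean_sub (X ω) i k) l
  rw [Pi.sub_apply, Matrix.mulVec_sum, Finset.sum_apply] at this
  exact (eq_add_of_sub_eq this).symm

end GaussianData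

end Setup

/-! ### Dynamic average consensus -/

theorem tendsto_zero_of_le_mul_add {a b : ℕ → ℝ} {ρ : ℝ} (hρ0 : 0 ≤ ρ) (hρ1 : ρ < 1)
    (ha : ∀ k, 0 ≤ a k) (h : ∀ k, a (k + 1) ≤ ρ * a k + b k) (hb : Tendsto b atTop (𝓝 0)) :
    Tendsto a atTop (𝓝 0) := by
  rw [Metric.tendsto_atTop]
  intro ε hε
  have hε' : 0 < (1 - ρ) * (ε / 2) := mul_pos (by linarith) (by linarith)
  obtain ⟨K, hK⟩ := eventually_atTop.1 (hb.eventually_lt_const hε')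
  have hpow : ∀ n, a (K + n) ≤ ρ ^ n * a K + ε / 2 := by
    intro n
    induction n with
    | zero => simp; linarith
    | succ n ih =>
      have h1 := h (K + n)
      have h2 := hK (K + n) (by omega)
      have h3 := mul_le_mul_of_nonneg_left ih hρ0
      rw [← add_assoc, pow_succ]
      nlinarith
  have hlim : Tendsto (fun n => ρ ^ n * a K) atTop (𝓝 0) := by
    simpa using (tendsto_pow_atTop_nhds_zero_of_lt_one hρ0 hρ1).mul_const (a K)
  obtain ⟨M, hM⟩ := eventually_atTop.1 (hlim.eventually_lt_const (half_pos hε))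
  refine ⟨K + M, fun n hn => ?_⟩
  obtain ⟨j, rfl⟩ := Nat.exists_eq_add_of_le (show K ≤ n by omega)
  have h1 := hpow j
  have h2 := hM j (by omega)
  rw [Real.dist_0_eq_abs, abs_of_nonneg (ha _)]
  linarith

section Consensus

variable {ι : Type*} [Fintype ι] {A : Matrix ι ι ℝ}

/-- The loss of energy under a doubly stochastic matrix. -/
theorem sum_sq_sub_sum_mulVec_sq (hrow : ∀ i, ∑ j, A i j = 1) (hcol : ∀ j, ∑ i, A i j = 1)
    (x : ι → ℝ) :
    ∑ i, x i ^ 2 - ∑ i, (A *ᵥ x) i ^ 2 = ∑ i, ∑ j, A i j * (x j - (A *ᵥ x) i) ^ 2 := by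
  have h1 : ∀ i, ∑ j, A i j * (x j - (A *ᵥ x) i) ^ 2 =
      ∑ j, A i j * x j ^ 2 - (A *ᵥ x) i ^ 2 := by
    intro i
    have hA : ∑ j, A i j * x j = (A *ᵥ x) i := rfl
    have : ∀ j, A i j * (x j - (A *ᵥ x) i) ^ 2 =
        A i j * x j ^ 2 - 2 * (A *ᵥ x) i * (A i j * x j) + (A *ᵥ x) i ^ 2 * A i j :=
      fun j => by ring
    simp only [this, Finset.sum_add_distrib, Finset.sum_sub_distrib, ← Finset.mul_sum, hA, hrow]
    ring
  simp only [h1, Finset.sum_sub_distrib]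
  rw [Finset.sum_comm]
  simp only [← Finset.sum_mul, hcol, one_mul]

/-- Without energy loss, x j equals the local average (A x) i along every edge from j to i. The
self-loop gives the same for x i, so x is constant along edges and hence along paths. -/
theorem eq_of_sum_sq_le (h0 : ∀ i j, 0 ≤ A i j) (hdiag : ∀ i, 0 < A i i)
    (hconn : ∀ i j, Relation.ReflTransGen (fun b a => 0 < A a b) i j)
    (hrow : ∀ i, ∑ j, A i j = 1) (hcol : ∀ j, ∑ i, A i j = 1) {x : ι → ℝ}
    (hx : ∑ i, x i ^ 2 ≤ ∑ i, (A *ᵥ x) i ^ 2) (i j : ι) : x i = x j := by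
  have h := sum_sq_sub_sum_mulVec_sq hrow hcol x
  have hnn : ∀ i j, 0 ≤ A i j * (x j - (A *ᵥ x) i) ^ 2 :=
    fun i j => mul_nonneg (h0 i j) (sq_nonneg _)
  have hzero : ∀ i j, A i j * (x j - (A *ᵥ x) i) ^ 2 = 0 := by
    have h1 : ∑ i, ∑ j, A i j * (x j - (A *ᵥ x) i) ^ 2 = 0 :=
      le_antisymm (by linarith) (Finset.sum_nonneg fun i _ => Finset.sum_nonneg fun j _ => hnn i j)
    intro i j
    have h2 := (Finset.sum_eq_zero_iff_of_nonneg
      fun i _ => Finset.sum_nonneg fun j _ => hnn i j).1 h1 i (Finset.mem_univ i)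
    exact (Finset.sum_eq_zero_iff_of_nonneg fun j _ => hnn i j).1 h2 j (Finset.mem_univ j)
  have hval : ∀ i j, 0 < A i j → x j = (A *ᵥ x) i := by
    intro i j hij
    have := (mul_eq_zero.1 (hzero i j)).resolve_left hij.ne'
    exact sub_eq_zero.1 (pow_eq_zero_iff two_ne_zero |>.1 this)
  induction hconn i j with
  | refl => rfl
  | tail _ hbc ih => rw [ih, hval _ _ hbc, ← hval _ _ (hdiag _)]

/-- A doubly stochastic matrix with positive diagonal and strongly connected graph is a strict
contraction on the vectors of mean zero. -/
theorem exists_contraction (h0 : ∀ i j, 0 ≤ A i j) (hdiag : ∀ i, 0 < A i i)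
    (hconn : ∀ i j, Relation.ReflTransGen (fun b a => 0 < A a b) i j)
    (hrow : ∀ i, ∑ j, A i j = 1) (hcol : ∀ j, ∑ i, A i j = 1) :
    ∃ ρ : ℝ, 0 ≤ ρ ∧ ρ < 1 ∧ ∀ x : ι → ℝ, ∑ i, x i = 0 →
      ∑ i, (A *ᵥ x) i ^ 2 ≤ ρ * ∑ i, x i ^ 2 := by
  set K : Set (ι → ℝ) := {x | ∑ i, x i = 0 ∧ ∑ i, x i ^ 2 = 1} with hK
  have hscale : ∀ x : ι → ℝ, ∑ i, x i = 0 → ∑ i, x i ^ 2 ≠ 0 →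
      (√(∑ i, x i ^ 2))⁻¹ • x ∈ K := by
    intro x hx hx'
    refine ⟨by simp [← Finset.mul_sum, hx], ?_⟩
    simp only [Pi.smul_apply, smul_eq_mul, mul_pow, ← Finset.mul_sum, inv_pow]
    rw [Real.sq_sqrt (Finset.sum_nonneg fun i _ => sq_nonneg _), inv_mul_cancel₀ hx']
  have hf : Continuous fun x : ι → ℝ => ∑ i, (A *ᵥ x) i ^ 2 := by
    simp only [Matrix.mulVec, dotProduct]
    fun_prop
  have hcomp : IsCompact K := by
    refine Metric.isCompact_of_isClosed_isBounded ?_ ?_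
    · exact (isClosed_eq (by fun_prop) continuous_const).inter
        (isClosed_eq (by fun_prop) continuous_const)
    · refine (Metric.isBounded_closedBall (x := (0 : ι → ℝ)) (r := 1)).subset fun x hx => ?_
      rw [mem_closedBall_zero_iff, pi_norm_le_iff_of_nonneg zero_le_one]
      intro i
      have := Finset.single_le_sum (f := fun i => x i ^ 2) (fun i _ => sq_nonneg _)
        (Finset.mem_univ i)
      exact (sq_le_one_iff_abs_le_one _).1 (this.trans_eq hx.2)
  have hsmall : ∀ x : ι → ℝ, ∑ i, x i ^ 2 = 0 → ∑ i, (A *ᵥ x) i ^ 2 = 0 := by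
    intro x hx
    have : x = 0 := by
      ext i
      have := (Finset.sum_eq_zero_iff_of_nonneg fun i _ => sq_nonneg (x i)).1 hx i
        (Finset.mem_univ i)
      simpa using this
    simp [this]
  rcases K.eq_empty_or_nonempty with hemp | hne
  -- An empty K leaves only the zero vector with mean zero.
  · refine ⟨0, le_rfl, one_pos, fun x hx => ?_⟩
    by_cases hx' : ∑ i, x i ^ 2 = 0
    · simp [hsmall x hx']
    · exact absurd (hscale x hx hx') (by simp [hemp])
  · obtain ⟨z, hz, hmax⟩ := hcomp.exists_isMaxOn hne hf.continuousOn
    refine ⟨∑ i, (A *ᵥ z) i ^ 2, Finset.sum_nonneg fun i _ => sq_nonneg _, ?_, fun x hx => ?_⟩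
    -- A maximal value of at least one would force the maximizer to be constant, hence zero by its
    -- mean, against its norm one.
    · by_contra! hcon
      have hconst := eq_of_sum_sq_le h0 hdiag hconn hrow hcol (x := z) (by rw [hz.2]; exact hcon)
      have hzero : ∀ i, z i = 0 := by
        intro i
        have h1 := hz.1
        rw [Finset.sum_congr rfl fun j _ => hconst j i, Finset.sum_const, nsmul_eq_mul] at h1
        refine (mul_eq_zero.1 h1).resolve_left ?_
        have := Fintype.card_pos_iff.2 ⟨i⟩
        simpa using Nat.pos_iff_ne_zero.1 this
      simpa [hzero] using hz.2
    · by_cases hx' : ∑ i, x i ^ 2 = 0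
      · simp [hsmall x hx', hx']
      · have h1 : ∑ i, (A *ᵥ ((√(∑ i, x i ^ 2))⁻¹ • x)) i ^ 2 ≤ ∑ i, (A *ᵥ z) i ^ 2 :=
          hmax (hscale x hx hx')
        have hnn : 0 ≤ ∑ i, x i ^ 2 := Finset.sum_nonneg fun i _ => sq_nonneg _
        simp only [Matrix.mulVec_smul, Pi.smul_apply, smul_eq_mul, mul_pow, ← Finset.mul_sum,
          inv_pow] at h1
        rwa [Real.sq_sqrt hnn, inv_mul_le_iff₀ (lt_of_le_of_ne hnn (Ne.symm hx')), mul_comm] at h1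

theorem tendsto_zero_of_contraction {ρ : ℝ} (hρ0 : 0 ≤ ρ) (hρ1 : ρ < 1)
    (hA : ∀ x : ι → ℝ, ∑ i, x i = 0 → ∑ i, (A *ᵥ x) i ^ 2 ≤ ρ * ∑ i, x i ^ 2)
    {x d : ℕ → ι → ℝ} (hx : ∀ k, x (k + 1) = A *ᵥ x k + d k) (hsum : ∀ k, ∑ i, x k i = 0)
    (hd : ∀ i, Tendsto (fun k => d k i) atTop (𝓝 0)) (i : ι) :
    Tendsto (fun k => x k i) atTop (𝓝 0) := by
  have hstep : ∀ k, ‖WithLp.toLp 2 (x (k + 1))‖ ≤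
      √ρ * ‖WithLp.toLp 2 (x k)‖ + ‖WithLp.toLp 2 (d k)‖ := by
    intro k
    rw [hx k, WithLp.toLp_add]
    refine (norm_add_le _ _).trans (add_le_add_left ?_ _)
    rw [EuclideanSpace.norm_eq, EuclideanSpace.norm_eq, ← Real.sqrt_mul hρ0]
    refine Real.sqrt_le_sqrt ?_
    simpa using hA (x k) (hsum k)
  have hd' : Tendsto (fun k => ‖WithLp.toLp 2 (d k)‖) atTop (𝓝 0) := by
    simp only [EuclideanSpace.norm_eq]
    have : Tendsto (fun k => √(∑ i, ‖d k i‖ ^ 2)) atTop (𝓝 √(∑ _i : ι, ‖(0 : ℝ)‖ ^ 2)) :=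
      (tendsto_finsetSum _ fun i _ => ((hd i).norm).pow 2).sqrt
    simpa using this
  have hlim := tendsto_zero_of_le_mul_add
    (a := fun k => ‖WithLp.toLp 2 (x k)‖) (Real.sqrt_nonneg ρ)
    (Real.sqrt_lt' one_pos |>.2 (by simpa using hρ1)) (fun k => norm_nonneg _) hstep hd'
  exact squeeze_zero_norm (fun k => PiLp.norm_apply_le (WithLp.toLp 2 (x k)) i) hlim

/-- Dynamic average consensus with convergent inputs reaches the average of the limits. -/
theorem tendsto_consensus (h0 : ∀ i j, 0 ≤ A i j) (hdiag : ∀ i, 0 < A i i)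
    (hconn : ∀ i j, Relation.ReflTransGen (fun b a => 0 < A a b) i j)
    (hrow : ∀ i, ∑ j, A i j = 1) (hcol : ∀ j, ∑ i, A i j = 1)
    {ψ ξ : ℕ → ι → ℝ} {p : ι → ℝ} (hξ0 : ξ 0 = ψ 0)
    (hξ : ∀ k, ξ (k + 1) = A *ᵥ ξ k + (ψ k - ψ (k - 1)))
    (hψ : ∀ i, Tendsto (fun k => ψ k i) atTop (𝓝 (p i))) (i : ι) :
    Tendsto (fun k => ξ k i) atTop (𝓝 ((∑ j, p j) / Fintype.card ι)) := by
  have hcard : (Fintype.card ι : ℝ) ≠ 0 :=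
    Nat.cast_ne_zero.2 (Fintype.card_pos_iff.2 ⟨i⟩).ne'
  have hAsum : ∀ x : ι → ℝ, ∑ i, (A *ᵥ x) i = ∑ i, x i := by
    intro x
    simp only [Matrix.mulVec, dotProduct]
    rw [Finset.sum_comm]
    simp only [← Finset.sum_mul, hcol, one_mul]
  have hAconst : ∀ (c : ℝ), A *ᵥ (fun _ => c) = fun _ => c := by
    intro c
    ext i
    simp [Matrix.mulVec, dotProduct, ← Finset.sum_mul, hrow]
  set avg : (ι → ℝ) → ℝ := fun x => (∑ i, x i) / Fintype.card ι with havg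
  have havg_sub : ∀ x : ι → ℝ, ∑ i, (x i - avg x) = 0 := by
    intro x
    simp only [Finset.sum_sub_distrib, Finset.sum_const, Finset.card_univ, nsmul_eq_mul, havg]
    rw [mul_div_cancel₀ _ hcard, sub_self]
  -- The sum of the states lags the inputs by one step. At k = 0 the truncated `k - 1` is 0, so the
  -- first increment vanishes.
  have hsumξ : ∀ k, ∑ i, ξ (k + 1) i = ∑ i, ψ k i := by
    intro k
    induction k with
    | zero => rw [hξ 0]; simp [hAsum, hξ0]
    | succ k ih =>
      rw [hξ (k + 1)]
      simp only [Pi.add_apply, Pi.sub_apply, Finset.sum_add_distrib, Finset.sum_sub_distrib, hAsum,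
        ih, Nat.add_sub_cancel]
      ring
  have hdlim : ∀ i, Tendsto (fun k => (ψ k - ψ (k - 1)) i) atTop (𝓝 0) := by
    intro i
    simpa using (hψ i).sub ((hψ i).comp (tendsto_sub_atTop_nat 1))
  have havg_lim : Tendsto (fun k => avg (ψ k - ψ (k - 1))) atTop (𝓝 0) := by
    have := (tendsto_finsetSum Finset.univ fun i _ => hdlim i).div_const (Fintype.card ι : ℝ)
    simpa only [Finset.sum_const_zero, zero_div] using this
  obtain ⟨ρ, hρ0, hρ1, hρ⟩ := exists_contraction h0 hdiag hconn hrow hcol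
  -- The deviation from the mean obeys the same recursion, driven by the mean-free part of the input
  -- increments.
  have hy := tendsto_zero_of_contraction hρ0 hρ1 hρ (x := fun k i => ξ k i - avg (ξ k))
    (d := fun k i => (ψ k - ψ (k - 1)) i - avg (ψ k - ψ (k - 1))) (fun k => by
      have h1 : (fun i => ξ k i - avg (ξ k)) = ξ k - fun _ => avg (ξ k) := rfl
      have h2 : avg (A *ᵥ ξ k + (ψ k - ψ (k - 1))) = avg (ξ k) + avg (ψ k - ψ (k - 1)) := by
        simp only [havg, Pi.add_apply, Finset.sum_add_distrib, hAsum, add_div]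
      rw [h1, Matrix.mulVec_sub, hAconst, hξ k, h2]
      ext i
      simp only [Pi.add_apply, Pi.sub_apply]
      ring) (fun k => havg_sub (ξ k))
    (fun i => by simpa using (hdlim i).sub havg_lim) i
  have havgξ : Tendsto (fun k => avg (ξ k)) atTop (𝓝 ((∑ j, p j) / Fintype.card ι)) := by
    rw [← tendsto_add_atTop_iff_nat 1]
    simp only [havg, hsumξ]
    exact (tendsto_finsetSum _ fun i _ => hψ i).div_const _
  simpa using hy.add havgξ

end Consensus

theorem Setup.tendsto_xi {N : ℕ} (E : Setup N) (hA : E.GoodGraph) (X : Sample N)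
    (q : Idx N ⊕ Idx N) {p : Fin N → ℝ}
    (hψ : ∀ i, Tendsto (fun k => E.psi X i k q) atTop (𝓝 (p i))) (i : Fin N) :
    Tendsto (fun k => E.xi X k i q) atTop (𝓝 ((∑ j, p j) / N)) := by
  obtain ⟨α, hα, hdiag, hw⟩ := hA.weights
  have h0 : ∀ i j, 0 ≤ E.A i j := fun i j =>
    (hw i j).elim (fun h => h.ge) fun h => hα.le.trans h.1
  have := tendsto_consensus h0 (fun i => hα.trans_le (hdiag i)) hA.strongly_connected hA.row_sum
    hA.col_sum (ψ := fun k i => E.psi X i k q) (ξ := fun k i => E.xi X k i q) rfl (fun k => by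
      ext i
      have h1 : ∑ j ∈ Finset.univ.erase i, E.A i j * (E.xi X k j q - E.xi X k i q) =
          ∑ j, E.A i j * (E.xi X k j q - E.xi X k i q) :=
        Finset.sum_erase _ (by simp)
      have h2 := hA.row_sum i
      simp only [xi, Pi.add_apply, Pi.sub_apply, Finset.sum_apply, Pi.smul_apply, smul_eq_mul, h1,
        Matrix.mulVec, dotProduct]
      simp only [mul_sub, Finset.sum_sub_distrib, ← Finset.sum_mul, h2]
      ring) hψ i
  simpa using this

/-! ### Quotients of estimates -/

/-- The worst corner moves the denominator towards zero and the numerator away from zero: s is the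
sign of a, and u is opposite to that of b. -/
theorem abs_div_sub_div_corner {a b x y : ℝ} (hx : 0 ≤ x) (hy : 0 ≤ y) (hyb : y < |b|) :
    ∃ s ∈ ({1, -1} : Set ℝ), ∃ u ∈ ({1, -1} : Set ℝ),
      |a / b - (a + s * x) / (b + u * y)| = (|a| * y + x * |b|) / (|b| * (|b| - y)) := by
  have hb : b ≠ 0 := fun h => by simp [h] at hyb; linarith
  rcases hb.lt_or_gt with hb' | hb'
  · rw [abs_of_neg hb'] at hyb ⊢
    have h1 : b + 1 * y ≠ 0 := by linarith
    have h2 : 0 < -b * (-b - y) := mul_pos (by linarith) (by linarith)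
    have h3 : -b - y ≠ 0 := by linarith
    rcases le_total 0 a with ha | ha
    · refine ⟨1, by simp, 1, by simp, ?_⟩
      rw [abs_of_nonneg ha, ← abs_of_nonneg (a := (a * y + x * -b) / (-b * (-b - y)))
        (div_nonneg (by nlinarith) h2.le)]
      congr 1
      rw [div_sub_div _ _ hb h1, div_eq_div_iff (mul_ne_zero hb h1) h2.ne']
      ring
    · refine ⟨-1, by simp, 1, by simp, ?_⟩
      rw [abs_of_nonpos ha, ← abs_of_nonneg (a := (-a * y + x * -b) / (-b * (-b - y)))
        (div_nonneg (by nlinarith) h2.le), ← abs_neg, neg_sub]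
      congr 1
      rw [div_sub_div _ _ h1 hb, div_eq_div_iff (mul_ne_zero h1 hb) h2.ne']
      ring
  · rw [abs_of_pos hb'] at hyb ⊢
    have h1 : b + -1 * y ≠ 0 := by linarith
    have h2 : 0 < b * (b - y) := mul_pos (by linarith) (by linarith)
    have h3 : b - y ≠ 0 := by linarith
    rcases le_total 0 a with ha | ha
    · refine ⟨1, by simp, -1, by simp, ?_⟩
      rw [abs_of_nonneg ha, ← abs_of_nonneg (a := (a * y + x * b) / (b * (b - y)))
        (div_nonneg (by nlinarith) h2.le), ← abs_neg, neg_sub]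
      congr 1
      rw [div_sub_div _ _ h1 hb, div_eq_div_iff (mul_ne_zero h1 hb) h2.ne']
      ring
    · refine ⟨-1, by simp, -1, by simp, ?_⟩
      rw [abs_of_nonpos ha, ← abs_of_nonneg (a := (-a * y + x * b) / (b * (b - y)))
        (div_nonneg (by nlinarith) h2.le)]
      congr 1
      rw [div_sub_div _ _ hb h1, div_eq_div_iff (mul_ne_zero hb h1) h2.ne']
      ring

/-- The numerator of the difference is linear in the two errors and gains the factor c; the
denominator is bounded by its worst case, as c ≤ 1. -/
theorem abs_div_sub_div_le {a b a' b' x y c : ℝ} (hc0 : 0 ≤ c) (hc1 : c ≤ 1) (hx : 0 ≤ x)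
    (hy : 0 ≤ y) (hyb : y < |b|) (ha : |a - a'| ≤ c * x) (hb : |b - b'| ≤ c * y) :
    |a / b - a' / b'| ≤ c * ((|a| * y + x * |b|) / (|b| * (|b| - y))) := by
  have hcy : c * y ≤ y := mul_le_of_le_one_left hy hc1
  have hb' : |b| - y ≤ |b'| := by
    have := abs_sub_abs_le_abs_sub b b'
    linarith
  have hb0 : 0 < |b| := hy.trans_lt hyb
  have hb0' : 0 < |b'| := by linarith
  have hbne : b ≠ 0 := abs_pos.1 hb0
  have hbne' : b' ≠ 0 := abs_pos.1 hb0'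
  have h1 : a / b - a' / b' = ((a - a') * b - a * (b - b')) / (b * b') := by
    field_simp
    ring
  have h2 : |(a - a') * b - a * (b - b')| ≤ c * (|a| * y + x * |b|) := by
    calc |(a - a') * b - a * (b - b')| ≤ |(a - a') * b| + |a * (b - b')| := abs_sub _ _
      _ = |a - a'| * |b| + |a| * |b - b'| := by rw [abs_mul, abs_mul]
      _ ≤ c * x * |b| + |a| * (c * y) := by gcongr
      _ = c * (|a| * y + x * |b|) := by ring
  rw [h1, abs_div, abs_mul b b', ← mul_div_assoc]
  exact div_le_div₀ (by positivity) h2 (mul_pos hb0 (by linarith))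
    (mul_le_mul_of_nonneg_left hb' hb0.le)

theorem min_le_quotient {a b x y va vb κ₁ κ₂ v v₀ b₀ : ℝ} (hκ₁ : 0 < κ₁) (hκ₂ : 0 < κ₂)
    (hv₀ : 0 < v₀) (hb₀ : 0 < b₀) (hva : 0 ≤ va) (hx : 0 ≤ x) (hb : b₀ ≤ y)
    (hlt : y < |b|) (hvb' : v₀ ≤ vb) (hη₁ : κ₁ * va ≤ x) (hη₂ : κ₂ * vb ≤ y)
    (hle : v ≤ va / b ^ 2 + (a / b ^ 2) ^ 2 * vb) :
    min (κ₁ * (v / 2) * b₀) (κ₂ * √(v / 2 * v₀)) ≤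
      (|a| * y + x * |b|) / (|b| * (|b| - y)) := by
  have hy : 0 < y := hb₀.trans_le hb
  have hb0 : 0 < |b| := hy.trans hlt
  have hvb : 0 < vb := hv₀.trans_le hvb'
  have hden : |b| * (|b| - y) ≤ b ^ 2 := by
    rw [← sq_abs b]
    nlinarith
  have hquot : (|a| * y + x * |b|) / b ^ 2 ≤ (|a| * y + x * |b|) / (|b| * (|b| - y)) :=
    div_le_div_of_nonneg_left (by positivity) (mul_pos hb0 (by linarith)) hden
  refine le_trans ?_ hquot
  have hb2 : 0 < b ^ 2 := by rw [← sq_abs]; positivity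
  -- One of the two summands of the variance is at least v / 2. The first makes x * |b| large, the
  -- second |a| * y.
  rcases le_total (v / 2) (va / b ^ 2) with hcase | hcase
  · refine (min_le_left _ _).trans ?_
    calc κ₁ * (v / 2) * b₀ ≤ κ₁ * (va / b ^ 2) * |b| := by gcongr; linarith
      _ = (κ₁ * va * |b|) / b ^ 2 := by ring
      _ ≤ (|a| * y + x * |b|) / b ^ 2 := by
        gcongr
        have h1 := mul_le_mul_of_nonneg_right hη₁ hb0.le
        have h2 : 0 ≤ |a| * y := by positivity
        linarith
  · refine (min_le_right _ _).trans ?_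
    have h1 : v / 2 ≤ (a / b ^ 2) ^ 2 * vb := by linarith
    have h2 : √(v / 2 * v₀) ≤ |a| / b ^ 2 * vb := by
      refine Real.sqrt_le_iff.2 ⟨by positivity, ?_⟩
      calc v / 2 * v₀ ≤ ((a / b ^ 2) ^ 2 * vb) * vb := by gcongr
        _ = (|a| / b ^ 2 * vb) ^ 2 := by rw [mul_pow, div_pow, div_pow, sq_abs]; ring
    calc κ₂ * √(v / 2 * v₀) ≤ κ₂ * (|a| / b ^ 2 * vb) := by gcongr
      _ = (|a| * (κ₂ * vb)) / b ^ 2 := by ring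
      _ ≤ (|a| * y + x * |b|) / b ^ 2 := by
        gcongr
        have h3 := mul_le_mul_of_nonneg_left hη₂ (abs_nonneg a)
        have h4 : 0 ≤ x * |b| := by positivity
        linarith

/-! ### From aggregated means to local and consensus estimates -/

namespace Setup

variable {N : ℕ} (E : Setup N) (X : Sample N) (δ : ℝ)

theorem quotient_le_ratioBound (i : Fin N) (k : ℕ) (c : Fin 3)
    (h : E.eta δ i k (Sum.inr ()) < |E.massEst X i k|) :
    (|E.momentEst X i k c| * E.eta δ i k (Sum.inr ())
        + E.eta δ i k (Sum.inl (i, c)) * |E.massEst X i k|)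
      / (|E.massEst X i k| * (|E.massEst X i k| - E.eta δ i k (Sum.inr ()))) ≤
    E.ratioBound X δ i k c := by
  obtain ⟨s, hs, u, hu, hsu⟩ := abs_div_sub_div_corner (a := E.momentEst X i k c)
    (E.eta_nonneg δ i k (Sum.inl (i, c))) (E.eta_nonneg δ i k (Sum.inr ())) h
  rw [← hsu]
  change E.cornerError X δ i k c s u ≤ _
  rcases hs with rfl | rfl <;> rcases hu with rfl | rfl <;> simp [ratioBound]

/-- If the errors of the aggregated estimates are at most a fraction of their bounds, the same holds
for the local estimates. -/
theorem abs_localMean_sub_le {c : ℝ} (hc0 : 0 ≤ c) (hc1 : c ≤ 1) (i : Fin N) (k : ℕ)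
    (hmass : E.eta δ i k (Sum.inr ()) < |E.massEst X i k|)
    (h : ∀ l, |E.aggMean X i k l - E.sys.theta i l| ≤ c * E.eta δ i k l) (l : Idx N) :
    |E.localMean X i k l - E.sys.vartheta l| ≤ c * E.localBound X δ i k l := by
  have hratio : ∀ x, |E.ratioEst X i k x - E.sys.r i x| ≤ c * E.ratioBound X δ i k x := by
    intro x
    have h1 := h (Sum.inl (i, x))
    have h2 := h (Sum.inr ())
    simp only [ManipulationSystem.theta, if_true] at h1 h2
    have h3 := abs_div_sub_div_le hc0 hc1 (E.eta_nonneg δ i k (Sum.inl (i, x)))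
      (E.eta_nonneg δ i k (Sum.inr ())) hmass h1 h2
    rw [mul_div_cancel_left₀ _ E.sys.mo_pos.ne'] at h3
    exact h3.trans (mul_le_mul_of_nonneg_left (E.quotient_le_ratioBound X δ i k x hmass) hc0)
  rcases l with ⟨j, x⟩ | _
  · by_cases hj : j = i
    · subst hj
      simpa [localMean, localBound, ManipulationSystem.vartheta] using hratio x
    · have h1 := h (Sum.inl (j, x))
      simp only [ManipulationSystem.theta, hj, if_false] at h1
      simp only [localMean, localBound, ManipulationSystem.vartheta, hj, if_false]
      calc |E.ratioEst X i k x + E.aggMean X i k (Sum.inl (j, x)) - E.sys.r j x|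
          = |(E.ratioEst X i k x - E.sys.r i x) +
              (E.aggMean X i k (Sum.inl (j, x)) - (E.sys.r j x - E.sys.r i x))| := by
            congr 1; ring
        _ ≤ _ := (abs_add_le _ _).trans (add_le_add (hratio x) h1)
        _ = _ := by ring
  · exact h (Sum.inr ())

variable {X δ}

theorem tendsto_localVar (hG : E.PositiveLimitPrecision X) (i : Fin N) (l : Idx N) :
    ∃ v : ℝ, 0 < v ∧ Tendsto (fun k => E.localVar X i k l) atTop (𝓝 v) := by
  obtain ⟨c, hc, h⟩ := hG i l
  exact ⟨c⁻¹, inv_pos.2 hc, (h.inv₀ hc.ne').congr fun k => by simp⟩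

theorem eventually_le_localVar (hG : E.PositiveLimitPrecision X) (i : Fin N) (l : Idx N) :
    ∃ v : ℝ, 0 < v ∧ ∀ᶠ k in atTop, v ≤ E.localVar X i k l := by
  obtain ⟨v, hv, h⟩ := E.tendsto_localVar hG i l
  exact ⟨v / 2, half_pos hv, h.eventually_const_le (half_lt_self hv)⟩

theorem eventually_le_eta_mass (hδ : δ ∈ Set.Ioo (0 : ℝ) 1) (hG : E.PositiveLimitPrecision X)
    (i : Fin N) : ∃ h : ℝ, 0 < h ∧ ∀ᶠ k in atTop, h ≤ E.eta δ i k (Sum.inr ()) := by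
  obtain ⟨v, hv, hev⟩ := E.eventually_le_localVar hG i (Sum.inr ())
  have hκ : 0 < quantile N δ / (3 * √(E.priorCov i 0 (Sum.inr ()) (Sum.inr ()))) :=
    div_pos (quantile_pos i hδ) (mul_pos three_pos
      (Real.sqrt_pos.2 (E.priorCov_posDef i 0).diag_pos))
  refine ⟨_, mul_pos hκ hv, hev.mono fun k hk => ?_⟩
  exact (mul_le_mul_of_nonneg_left hk hκ.le).trans (E.aggCov_le_eta δ i k (Sum.inr ()))

/-- For nonzero estimates this is an equality. A vanishing moment estimate makes the left side zero
by the convention for division, which loses the first summand on the right. -/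
theorem ratioVar_le (i : Fin N) (k : ℕ) (c : Fin 3) :
    E.ratioVar X i k c ≤
      E.aggCov i k (Sum.inl (i, c)) (Sum.inl (i, c)) / E.massEst X i k ^ 2 +
      (E.momentEst X i k c / E.massEst X i k ^ 2) ^ 2 * E.aggCov i k (Sum.inr ()) (Sum.inr ()) := by
  have hpos := fun l => (E.aggCov_posDef i k).diag_pos (i := l)
  rw [ratioVar, ratioEst]
  by_cases ha : E.momentEst X i k c = 0
  · have := (hpos (Sum.inl (i, c))).le
    simp only [ha, zero_div, ne_eq, OfNat.ofNat_ne_zero, not_false_eq_true, zero_pow, zero_mul,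
      add_zero]
    positivity
  · by_cases hb : E.massEst X i k = 0
    · simp [hb]
    · refine le_of_eq ?_
      field_simp

/-- The bound for the ratio estimate stays away from zero, because its variance does. -/
theorem eventually_le_ratioBound (hδ : δ ∈ Set.Ioo (0 : ℝ) 1) (hM : E.MassNondegenerate X δ)
    (hG : E.PositiveLimitPrecision X) (i : Fin N) (c : Fin 3) :
    ∃ h : ℝ, 0 < h ∧ ∀ᶠ k in atTop, h ≤ E.ratioBound X δ i k c := by
  obtain ⟨K, hK⟩ := hM
  obtain ⟨b₀, hb₀, hb⟩ := E.eventually_le_eta_mass hδ hG i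
  obtain ⟨v, hv, hvar⟩ := E.eventually_le_localVar hG i (Sum.inl (i, c))
  obtain ⟨v₀, hv₀, hmass⟩ := E.eventually_le_localVar hG i (Sum.inr ())
  have hκ : ∀ l, 0 < quantile N δ / (3 * √(E.priorCov i 0 l l)) := fun l =>
    div_pos (quantile_pos i hδ) (mul_pos three_pos
      (Real.sqrt_pos.2 (E.priorCov_posDef i 0).diag_pos))
  set κ₁ := quantile N δ / (3 * √(E.priorCov i 0 (Sum.inl (i, c)) (Sum.inl (i, c)))) with hκ₁
  set κ₂ := quantile N δ / (3 * √(E.priorCov i 0 (Sum.inr ()) (Sum.inr ()))) with hκ₂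
  have hκ₁' : 0 < κ₁ := hκ _
  have hκ₂' : 0 < κ₂ := hκ _
  refine ⟨min (κ₁ * (v / 2) * b₀) (κ₂ * √(v / 2 * v₀)), lt_min (by positivity) (by positivity), ?_⟩
  filter_upwards [hb, hvar, hmass, eventually_ge_atTop K] with k hb hvar hmass hk
  have hnd := hK i k hk
  have hlt : E.eta δ i k (Sum.inr ()) < |E.massEst X i k| := by linarith
  refine le_trans ?_ (E.quotient_le_ratioBound X δ i k c hlt)
  have hη₁ := E.aggCov_le_eta δ i k (Sum.inl (i, c))
  have hη₂ := E.aggCov_le_eta δ i k (Sum.inr ())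
  rw [← hκ₁] at hη₁
  rw [← hκ₂] at hη₂
  have hvar' : v ≤ E.ratioVar X i k c := by simpa [localVar] using hvar
  have hle := hvar'.trans (E.ratioVar_le i k c)
  have hmass' : v₀ ≤ E.aggCov i k (Sum.inr ()) (Sum.inr ()) := hmass
  have hpa := (E.aggCov_posDef i k).diag_pos (i := Sum.inl (i, c))
  have hxa := E.eta_nonneg δ i k (Sum.inl (i, c))
  exact min_le_quotient hκ₁' hκ₂' hv₀ hb₀ hpa.le hxa hb hlt hmass' hη₁ hη₂ hle

theorem eventually_le_localBound (hδ : δ ∈ Set.Ioo (0 : ℝ) 1) (hM : E.MassNondegenerate X δ)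
    (hG : E.PositiveLimitPrecision X) (i : Fin N) (l : Idx N) :
    ∃ h : ℝ, 0 < h ∧ ∀ᶠ k in atTop, h ≤ E.localBound X δ i k l := by
  rcases l with ⟨j, c⟩ | _
  · obtain ⟨h, hh, hev⟩ := E.eventually_le_ratioBound hδ hM hG i c
    refine ⟨h, hh, hev.mono fun k hk => ?_⟩
    by_cases hj : j = i
    · simpa [localBound, hj] using hk
    · simp only [localBound, hj, if_false]
      exact hk.trans (le_add_of_nonneg_right (E.eta_nonneg _ _ _ _))
  · exact E.eventually_le_eta_mass hδ hG i

theorem tendsto_localMean (hδ : δ ∈ Set.Ioo (0 : ℝ) 1) (hM : E.MassNondegenerate X δ)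
    (hG : E.PositiveLimitPrecision X)
    (hconv : ∀ i l, ∃ L, Tendsto (fun k => E.aggMean X i k l) atTop (𝓝 L)) (i : Fin N) (l : Idx N) :
    ∃ L, Tendsto (fun k => E.localMean X i k l) atTop (𝓝 L) := by
  have hratio : ∀ c, ∃ L, Tendsto (fun k => E.ratioEst X i k c) atTop (𝓝 L) := by
    intro c
    obtain ⟨K, hK⟩ := hM
    obtain ⟨b₀, hb₀, hb⟩ := E.eventually_le_eta_mass hδ hG i
    obtain ⟨a, ha⟩ := hconv i (Sum.inl (i, c))
    obtain ⟨b, hb'⟩ := hconv i (Sum.inr ())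
    -- The mass estimate exceeds its error bound, which stays away from zero, so its limit is
    -- nonzero and the quotient converges.
    have hb_pos : b₀ ≤ |b| := by
      refine ge_of_tendsto hb'.abs ?_
      filter_upwards [hb, eventually_ge_atTop K] with k hk hkK
      have := hK i k hkK
      change b₀ ≤ |E.massEst X i k|
      linarith
    exact ⟨a / b, ha.div hb' (abs_pos.1 (hb₀.trans_le hb_pos))⟩
  rcases l with ⟨j, c⟩ | _
  · obtain ⟨L, hL⟩ := hratio c
    by_cases hj : j = i
    · exact ⟨L, by simpa [localMean, hj] using hL⟩
    · obtain ⟨L', hL'⟩ := hconv i (Sum.inl (j, c))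
      exact ⟨L + L', by simpa [localMean, hj] using hL.add hL'⟩
  · exact hconv i (Sum.inr ())

theorem eventually_abs_consensusMean_sub_le (hA : E.GoodGraph) (hδ : δ ∈ Set.Ioo (0 : ℝ) 1)
    (hM : E.MassNondegenerate X δ) (hG : E.PositiveLimitPrecision X)
    (hconv : ∀ i l, ∃ L, Tendsto (fun k => E.aggMean X i k l) atTop (𝓝 L)) {c : ℝ} (hc0 : 0 ≤ c)
    (hc1 : c < 1) (i : Fin N) (l : Idx N) :
    ∀ᶠ k in atTop, (∀ i l, |E.aggMean X i k l - E.sys.theta i l| ≤ c * E.eta δ i k l) →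
      |E.consensusMean X i k l - E.sys.vartheta l| ≤ E.finalBound X δ k l := by
  have : Nonempty (Fin N) := ⟨i⟩
  choose x hx using fun j => E.tendsto_localMean hδ hM hG hconv j l
  choose q hq0 hq using fun j => hG j l
  choose h hh0 hh using fun j => E.eventually_le_localBound hδ hM hG j l
  choose v hv0 hv using fun j => E.eventually_le_localVar hG j l
  obtain ⟨j₀, hj₀⟩ := Finite.exists_min h
  have hN : (0 : ℝ) < N := Nat.cast_pos.2 i.pos
  have hqsum : 0 < ∑ j, q j := Finset.sum_pos (fun j _ => hq0 j) Finset.univ_nonempty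
  have hψ1 : ∀ j, Tendsto (fun k => E.psi X j k (Sum.inl l)) atTop (𝓝 (x j * q j)) := fun j =>
    ((hx j).mul (hq j)).congr fun k => by simp only [psi, mul_one_div]
  have hlim1 : Tendsto (fun k => E.consensusMean X i k l) atTop
      (𝓝 (((∑ j, x j * q j) / N) / ((∑ j, q j) / N))) :=
    (E.tendsto_xi hA X (Sum.inl l) hψ1 i).div (E.tendsto_xi hA X (Sum.inr l) hq i)
      (div_pos hqsum hN).ne'
  have hlim2 : Tendsto (fun k => (∑ j, E.localMean X j k l * (1 / E.localVar X j k l)) /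
      ∑ j, 1 / E.localVar X j k l) atTop (𝓝 ((∑ j, x j * q j) / ∑ j, q j)) :=
    (tendsto_finsetSum _ fun j _ => (hx j).mul (hq j)).div (tendsto_finsetSum _ fun j _ => hq j)
      hqsum.ne'
  have hdiff := hlim1.sub hlim2
  rw [div_div_div_cancel_right₀ hN.ne', sub_self] at hdiff
  -- Consensus estimate and weighted average share their limit, so their distance eventually drops
  -- below the reserve of 1 - c times the smallest lower bound of the local bounds.
  have hsmall := hdiff.abs.eventually_lt_const (u := (1 - c) * h j₀)
    (by rw [abs_zero]; exact mul_pos (by linarith) (hh0 j₀))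
  obtain ⟨K, hK⟩ := hM
  filter_upwards [hsmall, eventually_all.2 hh, eventually_all.2 hv, eventually_ge_atTop K]
    with k hsmall hh hv hk herr
  have hlv : ∀ j, 0 < E.localVar X j k l := fun j => (hv0 j).trans_le (hv j)
  set W := ∑ j, 1 / E.localVar X j k l with hW
  have hWpos : 0 < W := Finset.sum_pos (fun j _ => one_div_pos.2 (hlv j)) Finset.univ_nonempty
  have hw : ∀ j, 0 < 1 / (E.localVar X j k l * W) := fun j =>
    one_div_pos.2 (mul_pos (hlv j) hWpos)
  have hwsum : ∑ j, 1 / (E.localVar X j k l * W) = 1 := by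
    have : ∀ j, 1 / (E.localVar X j k l * W) = 1 / E.localVar X j k l / W := fun j =>
      (div_div _ _ _).symm
    simp only [this, ← Finset.sum_div]
    exact div_self hWpos.ne'
  have hfinal : E.finalBound X δ k l =
      ∑ j, 1 / (E.localVar X j k l * W) * E.localBound X δ j k l := by
    simp only [finalBound, one_div_mul_eq_div, hW]
  have hmean : (∑ j, E.localMean X j k l * (1 / E.localVar X j k l)) / W - E.sys.vartheta l =
      ∑ j, 1 / (E.localVar X j k l * W) * (E.localMean X j k l - E.sys.vartheta l) := by
    simp only [mul_sub, Finset.sum_sub_distrib, ← Finset.sum_mul, hwsum, one_mul, Finset.sum_div]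
    congr 1
    refine Finset.sum_congr rfl fun j _ => ?_
    rw [← div_div]
    ring
  have h1 : |(∑ j, E.localMean X j k l * (1 / E.localVar X j k l)) / W - E.sys.vartheta l| ≤
      c * E.finalBound X δ k l := by
    rw [hmean, hfinal, Finset.mul_sum]
    refine (Finset.abs_sum_le_sum_abs _ _).trans (Finset.sum_le_sum fun j _ => ?_)
    rw [abs_mul, abs_of_pos (hw j), mul_left_comm]
    have hmass := hK j k hk
    exact mul_le_mul_of_nonneg_left
      (E.abs_localMean_sub_le X δ hc0 hc1.le j k (by linarith) (herr j) l) (hw j).le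
  have h2 : h j₀ ≤ E.finalBound X δ k l := by
    calc h j₀ = ∑ j, 1 / (E.localVar X j k l * W) * h j₀ := by
          rw [← Finset.sum_mul, hwsum, one_mul]
      _ ≤ E.finalBound X δ k l := by
          rw [hfinal]
          exact Finset.sum_le_sum fun j _ =>
            mul_le_mul_of_nonneg_left ((hj₀ j).trans (hh j)) (hw j).le
  have h3 := mul_le_mul_of_nonneg_left h2 (show 0 ≤ 1 - c by linarith)
  calc |E.consensusMean X i k l - E.sys.vartheta l|
      ≤ |E.consensusMean X i k l - (∑ j, E.localMean X j k l * (1 / E.localVar X j k l)) / W| +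
        |(∑ j, E.localMean X j k l * (1 / E.localVar X j k l)) / W - E.sys.vartheta l| :=
      abs_sub_le _ _ _
    _ ≤ E.finalBound X δ k l := by linarith

theorem eventually_boundHolds (hA : E.GoodGraph) (hδ : δ ∈ Set.Ioo (0 : ℝ) 1)
    (hM : E.MassNondegenerate X δ) (hG : E.PositiveLimitPrecision X)
    (hconv : ∀ i l, ∃ L, Tendsto (fun k => E.aggMean X i k l) atTop (𝓝 L)) {c : ℝ} (hc0 : 0 ≤ c)
    (hc1 : c < 1) :
    ∀ᶠ k in atTop, (∀ i l, |E.aggMean X i k l - E.sys.theta i l| ≤ c * E.eta δ i k l) →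
      E.BoundHolds X δ k := by
  have := eventually_all.2 fun i => eventually_all.2 fun l =>
    E.eventually_abs_consensusMean_sub_le hA hδ hM hG hconv hc0 hc1 i l
  exact this.mono fun k hk herr i l => hk i l herr

end Setup

/-! ### The probabilistic bound -/

namespace Setup

variable {N : ℕ} (E : Setup N)

/-- All errors of the experts are at most the fraction `c` of their confidence bounds. -/
def ExpertsAccurate (X : Sample N) (δ c : ℝ) (k : ℕ) : Prop :=
  ∀ i m l, |E.expertMean X i m k l - E.sys.theta i l| ≤
    c * quantile N δ * √(E.expertCov i m k l l)

/-- Union bound over all experts and parameters for confidence bounds shrunk by the factor `c`. -/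
noncomputable def failureBound (N : ℕ) (δ c : ℝ) : ℝ :=
  6 * N * (3 * N + 1) * Real.exp (-(c * quantile N δ) ^ 2 / 2)

theorem failureBound_nonneg (N : ℕ) (δ c : ℝ) : 0 ≤ failureBound N δ c := by
  unfold failureBound
  positivity

/-- `quantile` is chosen so that the exponential equals δ / (6N(3N+1)); without agents the bound is
zero. -/
theorem failureBound_one_le (N : ℕ) {δ : ℝ} (hδ : δ ∈ Set.Ioo (0 : ℝ) 1) :
    failureBound N δ 1 ≤ δ := by
  rcases Nat.eq_zero_or_pos N with rfl | hN
  · simpa [failureBound] using hδ.1.le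
  · have hN' : (1 : ℝ) ≤ N := by exact_mod_cast hN
    have hlog : 0 ≤ Real.log (6 * N * (3 * N + 1) / δ) := by
      refine Real.log_nonneg ?_
      rw [one_le_div hδ.1]
      nlinarith [hδ.2]
    have hpos : (0 : ℝ) < 6 * N * (3 * N + 1) := by positivity
    rw [failureBound, quantile, one_mul, Real.sq_sqrt (by linarith), neg_div,
      mul_div_cancel_left₀ _ two_ne_zero, Real.exp_neg, Real.exp_log (div_pos hpos hδ.1), inv_div,
      mul_div_cancel₀ _ hpos.ne']

variable {E} {Ω : Type*} [MeasurableSpace Ω] {P : Measure Ω} [IsProbabilityMeasure P]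
  {X : Ω → Sample N}

theorem GaussianData.measure_not_expertsAccurate_le (hX : E.GaussianData P X) (δ : ℝ) {c : ℝ}
    (hc : 0 ≤ c) (k : ℕ) :
    P {ω | ¬ E.ExpertsAccurate (X ω) δ c k} ≤ ENNReal.ofReal (failureBound N δ c) := by
  have hsub : {ω | ¬ E.ExpertsAccurate (X ω) δ c k} ⊆ ⋃ q : Fin N × Fin 3 × Idx N,
      {ω | c * quantile N δ * √(E.expertCov q.1 q.2.1 k q.2.2 q.2.2) <
        |E.expertMean (X ω) q.1 q.2.1 k q.2.2 - E.sys.theta q.1 q.2.2|} := by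
    intro ω hω
    have hω' : ¬ E.ExpertsAccurate (X ω) δ c k := hω
    unfold ExpertsAccurate at hω'
    push Not at hω'
    obtain ⟨i, m, l, h⟩ := hω'
    exact Set.mem_iUnion.2 ⟨(i, m, l), h⟩
  refine (measure_mono hsub).trans ((measure_iUnion_fintype_le _ _).trans ?_)
  refine (Finset.sum_le_sum fun q _ => hX.measure_lt_abs_expertMean_sub_le q.1 q.2.1 k q.2.2
    (mul_nonneg hc (Real.sqrt_nonneg _))).trans ?_
  rw [Finset.sum_const, nsmul_eq_mul, ← ENNReal.ofReal_natCast,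
    ← ENNReal.ofReal_mul (Nat.cast_nonneg _)]
  refine ENNReal.ofReal_le_ofReal (le_of_eq ?_)
  simp only [Finset.card_univ, Fintype.card_prod, Fintype.card_sum, Fintype.card_fin,
    Fintype.card_unit, failureBound, quantile]
  push_cast
  ring

theorem GaussianData.ofReal_one_sub_failureBound_le (hA : E.GoodGraph) (hX : E.GaussianData P X)
    {δ : ℝ} (hδ : δ ∈ Set.Ioo (0 : ℝ) 1) {c : ℝ} (hc0 : 0 ≤ c) (hc1 : c < 1) :
    ENNReal.ofReal (1 - failureBound N δ c) ≤
      liminf (fun k : ℕ => P {ω | E.MassNondegenerate (X ω) δ →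
        E.PositiveLimitPrecision (X ω) → E.BoundHolds (X ω) δ k}) atTop := by
  -- The step from which accuracy implies the bound depends on ω. These increasing sets exhaust Ω up
  -- to a null set, which replaces uniformity; continuity from below needs no measurability of them.
  set D : ℕ → Set Ω := fun k => {ω | ∀ j, k ≤ j → E.MassNondegenerate (X ω) δ →
    E.PositiveLimitPrecision (X ω) → E.ExpertsAccurate (X ω) δ c j → E.BoundHolds (X ω) δ j}
  have hmono : Monotone D := fun a b hab ω hω j hj => hω j (hab.trans hj)
  have hunion : P (⋃ k, D k) = 1 := by
    rw [← measure_univ (μ := P)]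
    refine measure_congr (eventuallyEq_univ.2 ?_)
    filter_upwards [hX.ae_tendsto_aggMean] with ω hω
    rw [Set.mem_iUnion]
    by_cases hG : E.MassNondegenerate (X ω) δ ∧ E.PositiveLimitPrecision (X ω)
    · obtain ⟨K, hK⟩ := eventually_atTop.1
        (E.eventually_boundHolds hA hδ hG.1 hG.2 hω hc0 hc1)
      exact ⟨K, fun j hj _ _ hacc => hK j hj fun i l =>
        E.abs_aggMean_sub_le (X ω) δ c i j (hacc i) l⟩
    · exact ⟨0, fun j _ h1 h2 => absurd ⟨h1, h2⟩ hG⟩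
  have hlim : Tendsto (fun k => P (D k)) atTop (𝓝 1) := by
    rw [← hunion]
    exact tendsto_measure_iUnion_atTop hmono
  have hlim' : Tendsto (fun k => P (D k) - ENNReal.ofReal (failureBound N δ c)) atTop
      (𝓝 (1 - ENNReal.ofReal (failureBound N δ c))) :=
    ENNReal.Tendsto.sub hlim tendsto_const_nhds (Or.inl ENNReal.one_ne_top)
  rw [ENNReal.ofReal_sub _ (failureBound_nonneg N δ c), ENNReal.ofReal_one, ← hlim'.liminf_eq]
  refine liminf_le_liminf (Eventually.of_forall fun k => ?_)
  rw [tsub_le_iff_right]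
  refine le_trans ?_ (add_le_add_right (hX.measure_not_expertsAccurate_le δ hc0 k) _)
  refine (measure_mono fun ω hω => ?_).trans (measure_union_le _ _)
  by_cases h : E.ExpertsAccurate (X ω) δ c k
  · exact Or.inl fun h1 h2 => hω k le_rfl h1 h2 h
  · exact Or.inr h

theorem GaussianData.ofReal_one_sub_le (hA : E.GoodGraph) (hX : E.GaussianData P X)
    {δ : ℝ} (hδ : δ ∈ Set.Ioo (0 : ℝ) 1) :
    ENNReal.ofReal (1 - δ) ≤
      liminf (fun k : ℕ => P {ω | E.MassNondegenerate (X ω) δ →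
        E.PositiveLimitPrecision (X ω) → E.BoundHolds (X ω) δ k}) atTop := by
  refine (ENNReal.ofReal_le_ofReal (sub_le_sub_left (failureBound_one_le N hδ) 1)).trans ?_
  have hcont : Continuous fun c => ENNReal.ofReal (1 - failureBound N δ c) := by
    unfold failureBound
    exact ENNReal.continuous_ofReal.comp (by fun_prop)
  -- The left side of the claim is continuous in c and the liminf does not involve c, so c may tend
  -- to 1 from below.
  have hlim : Tendsto (fun c => ENNReal.ofReal (1 - failureBound N δ c)) (𝓝[<] 1)
      (𝓝 (ENNReal.ofReal (1 - failureBound N δ 1))) :=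
    hcont.continuousWithinAt
  refine le_of_tendsto hlim ?_
  filter_upwards [Ico_mem_nhdsLT (zero_lt_one' ℝ)] with c hc
  exact hX.ofReal_one_sub_failureBound_le hA hδ hc.1 hc.2

end Setup

end CoopManip

theorem theorem1 {N : ℕ} (E : CoopManip.Setup N) (hA : E.GoodGraph)
    {Ω : Type*} [MeasurableSpace Ω] (P : Measure Ω) [IsProbabilityMeasure P]
    (X : Ω → CoopManip.Sample N) (hX : E.GaussianData P X)
    (δ : ℝ) (hδ : δ ∈ Set.Ioo (0 : ℝ) 1) :
    ENNReal.ofReal (1 - δ) ≤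
        liminf (fun k : ℕ => P {ω | E.MassNondegenerate (X ω) δ →
          E.PositiveLimitPrecision (X ω) → E.BoundHolds (X ω) δ k}) atTop ∧
      ((∀ᵐ ω ∂P, E.MassNondegenerate (X ω) δ ∧ E.PositiveLimitPrecision (X ω)) →
        ENNReal.ofReal (1 - δ) ≤
          liminf (fun k : ℕ => P {ω | E.BoundHolds (X ω) δ k}) atTop) := by
  refine ⟨hX.ofReal_one_sub_le hA hδ, fun h => ?_⟩
  refine (hX.ofReal_one_sub_le hA hδ).trans (liminf_le_liminf (Eventually.of_forall fun k => ?_))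
  refine measure_mono_ae ?_
  filter_upwards [h] with ω hω hB
  exact hB hω.1 hω.2
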